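/- Let $G$ be a finite directed graph with vertex set $V$ and without directed cycles, and let $n\ge 1$. Let $\Theta=\Theta(G)$ be the Gaussian model on $G$, that is, the set of all covariance matrices $$\Sigma=(I-\Lambda)^{-T}\,\Omega\,(I-\Lambda)^{-1},$$ where $\Lambda\in\mathbb R^{V\times V}$ satisfies $\lambda_{kj}=0$ whenever $k\to j$ is not an edge of $G$, and $\Omega$ is a diagonal matrix with positive diagonal entries. Consider the log-likelihood function $$\ell_n(\Sigma,S)=-\tfrac n2\log\det\Sigma-\tfrac n2\operatorname{tr}(S\Sigma^{-1}).$$ Then: 1. The maximum likelihood degree of $\Theta$ is one: for generic complex symmetric $S$ (outside the zero set of some polynomial that does not vanish identically on the complex symmetric matrices), there is exactly one nonsingular point $\Sigma$ with $\det\Sigma\neq0$ of the Zariski closure $\overline{\Theta}$ of $\Theta$ in the complex symmetric matrices at which the differential of $\Sigma\mapsto\ell_n(\Sigma,S)$ vanishes on the tangent space of $\overline\Theta$. 2. For every $\Sigma\in\Theta$, the logarithmic Voronoi cell of $\Theta$ at $\Sigma$, $$\{S\succ0:\ \ell_n(\Sigma,S)\ge\ell_n(\Sigma',S)\text{ for all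 }\Sigma'\in\Theta\},$$ equals the log-normal spectrahedron of $\Theta$ at $\Sigma$, i.e. the set of all positive definite $S$ such that $\Sigma$ is a critical point of $\ell_n(\cdot,S)$ on $\Theta$ (the gradient of $\ell_n(\cdot,S)$ at $\Sigma$ is orthogonal to the Zariski tangent space of $\Theta$ at $\Sigma$). -/

import Mathlib

open scoped Matrix

namespace GaussianModel

noncomputable section

variable {V : Type*}

/-- A directed graph is acyclic when it has no directed cycle: there is no directed walk of
positive length from a vertex to itself. In particular there are no loops. -/
def IsAcyclic (G : Digraph V) : Prop :=
  ∀ v : V, ¬ Relation.TransGen G.Adj v v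

section Likelihood

variable [Fintype V] [DecidableEq V]

/-- The Gaussian model of a directed graph, given by its set of covariance matrices
`(I - Λ)⁻ᵀ Ω (I - Λ)⁻¹`, where `Λ` is a real matrix supported on the edges of `G`
(`Λ k j` is the regression coefficient of the edge `k → j` in `X = Λᵀ X + ε`) and `Ω` is the
diagonal matrix of the positive variances of `ε`. -/
def dagModel (G : Digraph V) : Set (Matrix V V ℝ) :=
  {Sig | ∃ (L : Matrix V V ℝ) (w : V → ℝ), (∀ k j, ¬ G.Adj k j → L k j = 0) ∧ (∀ j, 0 < w j) ∧
    Sig = ((1 - L)⁻¹)ᵀ * Matrix.diagonal w * (1 - L)⁻¹}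

/-- The log-likelihood function of the centred Gaussian distribution with covariance matrix `Sig`
for `n` observations with sample covariance matrix `S` (up to an additive constant). -/
def logLik (n : ℕ) (Sig S : Matrix V V ℝ) : ℝ :=
  -((n : ℝ) / 2) * Real.log Sig.det - ((n : ℝ) / 2) * (S * Sig⁻¹).trace

/-- The logarithmic Voronoi cell of the model `Θ` at `Sig`: all positive definite `S` for which
`Sig` maximizes the log-likelihood function over `Θ`. -/
def logVoronoi (n : ℕ) (Θ : Set (Matrix V V ℝ)) (Sig : Matrix V V ℝ) : Set (Matrix V V ℝ) :=
  {S | S.PosDef ∧ ∀ Sig' ∈ Θ, logLik n Sig' S ≤ logLik n Sig S}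

end Likelihood

/-- A square matrix as a point of affine space with coordinates indexed by pairs. -/
def coords {k : Type*} (M : Matrix V V k) : V × V → k := fun p => M p.1 p.2

/-- The ideal of all polynomials in the matrix entries that vanish on a set of matrices. -/
def matrixIdeal {k : Type*} [Field k] (X : Set (Matrix V V k)) :
    Ideal (MvPolynomial (V × V) k) :=
  MvPolynomial.vanishingIdeal k (coords '' X)

/-- The (Zariski) tangent space at `M` of a set `X` of matrices: the common kernel of the
differentials at `M` of all polynomials vanishing on `X`. -/
def tangentSpace {k : Type*} [Field k] [Fintype V] (X : Set (Matrix V V k)) (M : Matrix V V k) :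
    Set (Matrix V V k) :=
  {T | ∀ f ∈ matrixIdeal X,
    ∑ p : V × V, MvPolynomial.eval (coords M) (MvPolynomial.pderiv p f) * coords T p = 0}

section LogNormal

variable [Fintype V] [DecidableEq V]

/-- The log-normal matrix space of `Θ` at `Sig`: all symmetric `S` such that `Sig` is a critical
point on `Θ` of the log-likelihood function for `S`, i.e. such that the gradient of the
log-likelihood function at `Sig` is orthogonal to the tangent space of `Θ` at `Sig`. -/
def logNormalSpace (n : ℕ) (Θ : Set (Matrix V V ℝ)) (Sig : Matrix V V ℝ) :
    Set (Matrix V V ℝ) :=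
  {S | S.IsSymm ∧ ∀ T ∈ tangentSpace Θ Sig, HasLineDerivAt ℝ (fun M => logLik n M S) 0 Sig T}

/-- The log-normal spectrahedron: the positive definite part of the log-normal matrix space. -/
def logNormalSpectrahedron (n : ℕ) (Θ : Set (Matrix V V ℝ)) (Sig : Matrix V V ℝ) :
    Set (Matrix V V ℝ) :=
  {S | S.PosDef} ∩ logNormalSpace n Θ Sig

end LogNormal

/-- The Zariski closure of a set of real matrices in the space of complex matrices. (If the
given matrices are symmetric, then so are all matrices in the closure.) -/
def complexClosure (Θ : Set (Matrix V V ℝ)) : Set (Matrix V V ℂ) :=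
  {M | coords M ∈ MvPolynomial.zeroLocus ℂ
    (matrixIdeal ((fun A : Matrix V V ℝ => A.map (algebraMap ℝ ℂ)) '' Θ))}

/-- The local ring at the point `M` of the affine variety with underlying set `X`: the coordinate
ring of `X` localized at the functions that are given by polynomials not vanishing at `M`. -/
abbrev LocalRingAt (X : Set (Matrix V V ℂ)) (M : Matrix V V ℂ) : Type _ :=
  Localization (Submonoid.map (Ideal.Quotient.mk (matrixIdeal X))
    (MvPolynomial.vanishingIdeal ℂ {coords M}).primeCompl)

/-- `M` is a nonsingular point of the affine variety `X`. -/
def IsNonsingularPoint (X : Set (Matrix V V ℂ)) (M : Matrix V V ℂ) : Prop :=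
  M ∈ X ∧ IsRegularLocalRing (LocalRingAt X M)

section MLDegree

variable [Fintype V] [DecidableEq V]

/-- The differential at `Sig`, in direction `T`, of the complexified log-likelihood function
`-(n/2) log det Sig - (n/2) tr (S Sig⁻¹)`. The differential of the multivalued function `log det`
is the logarithmic derivative of `det`, whatever branch is chosen. -/
def complexScore (n : ℕ) (Sig S T : Matrix V V ℂ) : ℂ :=
  -((n : ℂ) / 2) * logDeriv (fun t : ℂ => (Sig + t • T).det) 0
    - ((n : ℂ) / 2) * deriv (fun t : ℂ => (S * (Sig + t • T)⁻¹).trace) 0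

/-- The nonsingular complex critical points of the log-likelihood function for `S` on the Zariski
closure of `Θ`: the nonsingular points of the closure, in the domain `det ≠ 0` of the
log-likelihood function, at which its differential vanishes on the tangent space. -/
def complexCriticalPoints (n : ℕ) (Θ : Set (Matrix V V ℝ)) (S : Matrix V V ℂ) :
    Set (Matrix V V ℂ) :=
  {Sig | IsNonsingularPoint (complexClosure Θ) Sig ∧ Sig.det ≠ 0 ∧
    ∀ T ∈ tangentSpace (complexClosure Θ) Sig, complexScore n Sig S T = 0}

/-- The model `Θ` has maximum likelihood degree `d`: for generic symmetric `S`, i.e. outside the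
zero set of a polynomial that does not vanish identically on the complex symmetric matrices, the
log-likelihood function has exactly `d` nonsingular complex critical points. -/
def HasMLDegree (n : ℕ) (Θ : Set (Matrix V V ℝ)) (d : ℕ) : Prop :=
  ∃ P : MvPolynomial (V × V) ℂ,
    (∃ S : Matrix V V ℂ, S.IsSymm ∧ MvPolynomial.eval (coords S) P ≠ 0) ∧
    ∀ S : Matrix V V ℂ, S.IsSymm → MvPolynomial.eval (coords S) P ≠ 0 →
      (complexCriticalPoints n Θ S).encard = d

end MLDegree

end

end GaussianModel

namespace GaussianModel

noncomputable section

open Matrix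

/-! ### Polynomial parametrization and normal equations over a commutative ring. -/

section Parametrization

variable {V : Type*} {G : Digraph V} {R : Type*} [CommRing R]

/-! Acyclicity makes `L` nilpotent, so the inverse of `1 - L` is a finite geometric series and the
covariance matrix is polynomial in the edge coefficients and variances, over any commutative ring.
Conversely, these parameters are regression coefficients and residual variances: the normal
equations determine them from second moments `x` by Cramer's rule, with denominator `denom G x`, the
product of the parent minors. Hence the parametrization is birational onto the closure, and the same
rational map sends a sample covariance `S` to the parameters of its critical point.

The link with the likelihood is the score matrix `H = Σ⁻¹SΣ⁻¹ - Σ⁻¹`, for which `S = Σ + ΣHΣ`. For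
nonzero variances, `H` is orthogonal to the image of the differential of the parametrization exactly
when the parameters of `Σ` solve the normal equations for `S` (`score_transformed`). Where the
denominator is nonzero, this image is the whole tangent space (`exists_eq_covarianceDiff`, by dual
numbers) and the point is nonsingular (`isNonsingularPoint_covariance`). This gives existence of a
critical point for generic `S`.

Uniqueness must also cover points of the closure outside the image of the parametrization. At a
critical point `M`, linear duality writes `H` as the gradient at `M` of some `F` in the ideal. The
symmetrized gradient of `F` is normal to the model at every parametrized point, so the normal
equations hold along the parametrization for moments that vary polynomially with the point. The
resulting identity passes to the closure and, evaluated at `M`, recovers `M` from `S`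
(`eq_covarianceOf_normalParam`).

For real positive definite `S`, the log-likelihood splits over vertices into terms `log w + r / w`,
with `r` the residual variance. The normal equations characterize the joint minimum of these terms,
as well as criticality, so both sets in the second claim are described by the same equations. -/

/-- The matrix `L` is supported on the edges of `G`. -/
def IsSupported (G : Digraph V) (L : Matrix V V R) : Prop :=
  ∀ k j, ¬ G.Adj k j → L k j = 0

lemma IsSupported.map {S : Type*} [CommRing S] {L : Matrix V V R} (hL : IsSupported G L)
    (f : R →+* S) : IsSupported G (L.map f) := fun k j h => by
  rw [map_apply, hL k j h, map_zero]

/-- The rank of a vertex is its number of proper ancestors. By acyclicity a vertex is not its own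
ancestor, which gives both strict inequalities. -/
lemma exists_rank [Fintype V] (hG : IsAcyclic G) :
    ∃ r : V → ℕ, (∀ k j, G.Adj k j → r k < r j) ∧ ∀ v, r v < Fintype.card V := by
  classical
  refine ⟨fun v => (Finset.univ.filter fun u => Relation.TransGen G.Adj u v).card, ?_, ?_⟩
  · intro k j h
    refine Finset.card_lt_card (Finset.ssubset_iff_of_subset ?_ |>.2 ⟨k, ?_, ?_⟩)
    · intro u hu
      simp only [Finset.mem_filter, Finset.mem_univ, true_and] at hu ⊢
      exact hu.tail h
    · simpa using Relation.TransGen.single h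
    · simpa using hG k
  · intro v
    refine Finset.card_lt_univ_of_notMem (x := v) ?_
    simpa using hG v

variable [Fintype V] [DecidableEq V]

lemma IsSupported.transGen_of_pow_ne_zero {L : Matrix V V R} (hL : IsSupported G L) {n : ℕ} :
    ∀ {i j : V}, (L ^ (n + 1)) i j ≠ 0 → Relation.TransGen G.Adj i j := by
  induction n with
  | zero =>
    intro i j h
    refine Relation.TransGen.single (not_not.1 fun h' => h ?_)
    simpa using hL i j h'
  | succ n ih =>
    intro i j h
    rw [pow_succ, mul_apply] at h
    obtain ⟨k, -, hk⟩ := Finset.exists_ne_zero_of_sum_ne_zero h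
    exact (ih (left_ne_zero_of_mul hk)).tail
      (not_not.1 fun h' => right_ne_zero_of_mul hk (hL k j h'))

lemma IsSupported.pow_card (hG : IsAcyclic G) {L : Matrix V V R} (hL : IsSupported G L) :
    L ^ Fintype.card V = 0 := by
  obtain ⟨r, hr, hc⟩ := exists_rank hG
  -- A nonzero entry of `L ^ n` comes from a walk of length `n`, and each edge raises the rank by at
  -- least one.
  have key : ∀ n i j, (L ^ n) i j ≠ 0 → r i + n ≤ r j := by
    intro n
    induction n with
    | zero =>
      intro i j h
      have : i = j := by
        by_contra hij
        exact h (by simp [one_apply_ne hij])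
      simp [this]
    | succ n ih =>
      intro i j h
      rw [pow_succ, mul_apply] at h
      obtain ⟨k, -, hk⟩ := Finset.exists_ne_zero_of_sum_ne_zero h
      have h1 := ih _ _ (left_ne_zero_of_mul hk)
      have h2 := hr k j (not_not.1 fun h' => right_ne_zero_of_mul hk (hL k j h'))
      omega
  ext i j
  by_contra h
  have h1 := key _ i j h
  have h2 := hc j
  omega

/-- The truncated geometric series of `L`, the inverse of `1 - L` when `L` is supported on an
acyclic graph. -/
def neumann (L : Matrix V V R) : Matrix V V R := ∑ i ∈ Finset.range (Fintype.card V), L ^ i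

lemma neumann_mul (hG : IsAcyclic G) {L : Matrix V V R} (hL : IsSupported G L) :
    neumann L * (1 - L) = 1 := by
  rw [neumann, geom_sum_mul_neg, hL.pow_card hG, sub_zero]

lemma mul_neumann (hG : IsAcyclic G) {L : Matrix V V R} (hL : IsSupported G L) :
    (1 - L) * neumann L = 1 := by
  rw [neumann, mul_neg_geom_sum, hL.pow_card hG, sub_zero]

lemma eq_neumann (hG : IsAcyclic G) {L N : Matrix V V R} (hL : IsSupported G L)
    (h : (1 - L) * N = 1) : N = neumann L := by
  rw [← one_mul N, ← neumann_mul hG hL, mul_assoc, h, mul_one]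

lemma inv_one_sub (hG : IsAcyclic G) {L : Matrix V V R} (hL : IsSupported G L) :
    (1 - L)⁻¹ = neumann L :=
  inv_eq_right_inv (mul_neumann hG hL)

lemma neumann_map {S : Type*} [CommRing S] (f : R →+* S) (L : Matrix V V R) :
    (neumann L).map f = neumann (L.map f) := by
  simp only [neumann, ← RingHom.mapMatrix_apply, map_sum, map_pow]

lemma neumann_self (hG : IsAcyclic G) {L : Matrix V V R} (hL : IsSupported G L) (j : V) :
    neumann L j j = 1 := by
  have : Nonempty V := ⟨j⟩
  obtain ⟨m, hm⟩ : ∃ m, Fintype.card V = m + 1 :=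
    Nat.exists_eq_succ_of_ne_zero Fintype.card_ne_zero
  rw [neumann, hm, Finset.sum_range_succ', Matrix.add_apply, Matrix.sum_apply,
    Finset.sum_eq_zero, pow_zero, one_apply_eq, zero_add]
  intro i _
  by_contra h
  exact hG j (hL.transGen_of_pow_ne_zero h)

/-- A walk from `j` back to `k` would close a directed cycle with the edge. -/
lemma neumann_of_adj (hG : IsAcyclic G) {L : Matrix V V R} (hL : IsSupported G L) {k j : V}
    (h : G.Adj k j) : neumann L j k = 0 := by
  rw [neumann, Matrix.sum_apply, Finset.sum_eq_zero]
  rintro (_ | i) _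
  · rw [pow_zero, one_apply_ne]
    rintro rfl
    exact hG _ (Relation.TransGen.single h)
  · by_contra h'
    exact hG j ((hL.transGen_of_pow_ne_zero h').tail h)

/-- The covariance matrix of the Gaussian model with regression coefficients `L` and error
variances `w`. -/
def covariance (L : Matrix V V R) (w : V → R) : Matrix V V R :=
  (neumann L)ᵀ * diagonal w * neumann L

lemma covariance_map {S : Type*} [CommRing S] (f : R →+* S) (L : Matrix V V R) (w : V → R) :
    (covariance L w).map f = covariance (L.map f) (fun v => f (w v)) := by
  rw [covariance, Matrix.map_mul, Matrix.map_mul, transpose_map, neumann_map, covariance,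
    diagonal_map (map_zero f)]

lemma covariance_isSymm (L : Matrix V V R) (w : V → R) : (covariance L w).IsSymm := by
  simp [IsSymm, covariance, transpose_mul, mul_assoc]

lemma covariance_mul (hG : IsAcyclic G) {L : Matrix V V R} (hL : IsSupported G L) (w : V → R) :
    covariance L w * (1 - L) = (neumann L)ᵀ * diagonal w := by
  rw [covariance, mul_assoc, neumann_mul hG hL, mul_one]

lemma det_neumann_isUnit (hG : IsAcyclic G) {L : Matrix V V R} (hL : IsSupported G L) :
    IsUnit (neumann L).det := by
  refine IsUnit.of_mul_eq_one (1 - L).det ?_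
  rw [← det_mul, neumann_mul hG hL, det_one]

lemma mem_dagModel_iff (hG : IsAcyclic G) {Sig : Matrix V V ℝ} :
    Sig ∈ dagModel G ↔ ∃ (L : Matrix V V ℝ) (w : V → ℝ), IsSupported G L ∧ (∀ j, 0 < w j) ∧
      Sig = covariance L w := by
  constructor
  · rintro ⟨L, w, hL, hw, rfl⟩
    exact ⟨L, w, hL, hw, by rw [inv_one_sub hG hL, covariance]⟩
  · rintro ⟨L, w, hL, hw, rfl⟩
    exact ⟨L, w, hL, hw, by rw [inv_one_sub hG hL, covariance]⟩

/-- The normal equations: `L` and `w` are the coefficients and the residual variances of the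
regressions of the variables on their parents, for the second moments `x`. -/
def NormalEquations (G : Digraph V) (x L : Matrix V V R) (w : V → R) : Prop :=
  (∀ k j, G.Adj k j → (x * (1 - L)) k j = 0) ∧ ∀ j, (x * (1 - L)) j j = w j

/-- Right multiplication by `1 - L` leaves `Nᵀ * diagonal w` with `N = neumann L`, and `N` has unit
diagonal and vanishes against the direction of edges. -/
lemma normalEquations_covariance (hG : IsAcyclic G) {L : Matrix V V R} (hL : IsSupported G L)
    (w : V → R) : NormalEquations G (covariance L w) L w := by
  refine ⟨fun k j h => ?_, fun j => ?_⟩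
  · rw [covariance_mul hG hL, mul_diagonal, transpose_apply, neumann_of_adj hG hL h, zero_mul]
  · rw [covariance_mul hG hL, mul_diagonal, transpose_apply, neumann_self hG hL, one_mul]

open Classical in
/-- The second moments of the parents of `j`. -/
def parentBlock (G : Digraph V) (x : Matrix V V R) (j : V) :
    Matrix {p // G.Adj p j} {p // G.Adj p j} R :=
  x.submatrix Subtype.val Subtype.val

open Classical in
/-- The common denominator of the solutions of the normal equations. -/
def denom (G : Digraph V) (x : Matrix V V R) : R := ∏ j, (parentBlock G x j).det

open Classical in
/-- The numerators of the regression coefficients, by Cramer's rule. -/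
def numCoeff (G : Digraph V) (x : Matrix V V R) : Matrix V V R := fun k j =>
  if h : G.Adj k j then
    (∏ i ∈ Finset.univ.erase j, (parentBlock G x i).det) *
      ((parentBlock G x j).adjugate *ᵥ fun p => x p.1 j) ⟨k, h⟩
  else 0

/-- The numerators of the residual variances. -/
def numVar (G : Digraph V) (x : Matrix V V R) : V → R := fun j =>
  denom G x * x j j - ∑ k, x j k * numCoeff G x k j

lemma numCoeff_isSupported (x : Matrix V V R) : IsSupported G (numCoeff G x) := fun _ _ h =>
  dif_neg h

lemma denom_map {S : Type*} [CommRing S] (f : R →+* S) (x : Matrix V V R) :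
    denom G (x.map f) = f (denom G x) := by
  classical
  rw [denom, denom, map_prod]
  refine Finset.prod_congr rfl fun j _ => ?_
  rw [RingHom.map_det]
  rfl

lemma numCoeff_map {S : Type*} [CommRing S] (f : R →+* S) (x : Matrix V V R) (k j : V) :
    numCoeff G (x.map f) k j = f (numCoeff G x k j) := by
  classical
  rw [numCoeff, numCoeff]
  split_ifs with h
  · have hb : ∀ i, parentBlock G (x.map f) i = f.mapMatrix (parentBlock G x i) := fun _ => rfl
    have ha : (parentBlock G x j).adjugate.map f = (f.mapMatrix (parentBlock G x j)).adjugate :=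
      RingHom.map_adjugate f _
    rw [map_mul, map_prod, RingHom.map_mulVec, ha]
    simp only [RingHom.map_det, hb]
    rfl
  · rw [map_zero]

lemma numVar_map {S : Type*} [CommRing S] (f : R →+* S) (x : Matrix V V R) (j : V) :
    numVar G (x.map f) j = f (numVar G x j) := by
  simp [numVar, numCoeff_map, denom_map]

open Classical in
lemma mul_one_sub_apply_of_isSupported {x L : Matrix V V R} (hL : IsSupported G L) (k j : V) :
    (x * (1 - L)) k j = x k j - ∑ p : {p // G.Adj p j}, x k p * L p j := by
  rw [mul_sub, mul_one, Matrix.sub_apply, mul_apply]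
  congr 1
  rw [← Finset.sum_subtype (Finset.univ.filter fun p => G.Adj p j) (by simp)
    fun p => x k p * L p j, Finset.sum_filter]
  refine Finset.sum_congr rfl fun p _ => ?_
  split_ifs with h
  · rfl
  · rw [hL p j h, mul_zero]

/-- Column `j` of the normal equations is a linear system with matrix `parentBlock G x j`;
multiplying by its adjugate gives the solution without inverting anything. -/
lemma NormalEquations.denom_mul {x L : Matrix V V R} {w : V → R} (hL : IsSupported G L)
    (h : NormalEquations G x L w) :
    (∀ k j, denom G x * L k j = numCoeff G x k j) ∧ ∀ j, denom G x * w j = numVar G x j := by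
  classical
  have h1 : ∀ k j, denom G x * L k j = numCoeff G x k j := by
    intro k j
    rw [numCoeff]
    split_ifs with hkj
    · have hx : parentBlock G x j *ᵥ (fun p => L p.1 j) = fun p => x p.1 j := by
        funext p
        have := h.1 p.1 j p.2
        rw [mul_one_sub_apply_of_isSupported hL, sub_eq_zero] at this
        rw [this]
        rfl
      rw [← hx, mulVec_mulVec, adjugate_mul, smul_mulVec, one_mulVec, denom,
        ← Finset.prod_erase_mul _ _ (Finset.mem_univ j)]
      simp only [Pi.smul_apply, smul_eq_mul, mul_assoc]
    · rw [hL k j hkj, mul_zero]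
  refine ⟨h1, fun j => ?_⟩
  rw [numVar, ← h.2 j, mul_sub, mul_one, Matrix.sub_apply, mul_apply, mul_sub, Finset.mul_sum]
  congr 1
  refine Finset.sum_congr rfl fun k _ => ?_
  rw [← h1]
  ring

lemma normalEquations_of_denom_mul_eq_one {x : Matrix V V R} {b : R} (hb : denom G x * b = 1) :
    NormalEquations G x (b • numCoeff G x) (b • numVar G x) := by
  classical
  constructor
  · intro k j hkj
    rw [mul_one_sub_apply_of_isSupported
      (fun k j h => by rw [Matrix.smul_apply, numCoeff_isSupported x k j h, smul_zero]), sub_eq_zero]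
    have hx : (parentBlock G x j *ᵥ fun p => numCoeff G x p.1 j) ⟨k, hkj⟩ =
        denom G x * x k j := by
      have : (fun p : {p // G.Adj p j} => numCoeff G x p.1 j) =
          (∏ i ∈ Finset.univ.erase j, (parentBlock G x i).det) •
            ((parentBlock G x j).adjugate *ᵥ fun p => x p.1 j) := by
        funext p
        rw [numCoeff, dif_pos p.2]
        rfl
      rw [this, mulVec_smul, mulVec_mulVec, mul_adjugate, smul_mulVec, one_mulVec, denom,
        ← Finset.prod_erase_mul _ _ (Finset.mem_univ j)]
      simp only [Pi.smul_apply, smul_eq_mul, mul_assoc]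
    have hx' : ∑ p : {p // G.Adj p j}, x k p * numCoeff G x p j = denom G x * x k j := hx
    calc x k j = b * (denom G x * x k j) := by rw [← mul_assoc, mul_comm b, hb, one_mul]
      _ = _ := by
        rw [← hx', Finset.mul_sum]
        refine Finset.sum_congr rfl fun p _ => ?_
        rw [Matrix.smul_apply, smul_eq_mul]
        ring
  · intro j
    rw [mul_sub, mul_one, Matrix.sub_apply, mul_apply, Pi.smul_apply, numVar, smul_eq_mul, mul_sub,
      ← mul_assoc, mul_comm b, hb, one_mul, Finset.mul_sum]
    congr 1
    refine Finset.sum_congr rfl fun k _ => ?_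
    rw [Matrix.smul_apply, smul_eq_mul]
    ring

/-- Uniqueness of the regression parameters. Only a unit denominator is needed, so it also applies
over the dual numbers. -/
lemma NormalEquations.eq_smul {x L : Matrix V V R} {w : V → R} (hL : IsSupported G L)
    (h : NormalEquations G x L w) {b : R} (hb : denom G x * b = 1) :
    L = b • numCoeff G x ∧ w = b • numVar G x := by
  obtain ⟨h1, h2⟩ := h.denom_mul hL
  constructor
  · ext k j
    rw [Matrix.smul_apply, ← h1, smul_eq_mul, ← mul_assoc, mul_comm b, hb, one_mul]
  · ext j
    rw [Pi.smul_apply, ← h2, smul_eq_mul, ← mul_assoc, mul_comm b, hb, one_mul]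

lemma denom_one : denom G (1 : Matrix V V R) = 1 := by
  classical
  refine Finset.prod_eq_one fun j _ => ?_
  rw [parentBlock, submatrix_one _ Subtype.val_injective, det_one]

/-- The differential of the parametrization of the covariance matrices. -/
def covarianceDiff (L : Matrix V V R) (w : V → R) (L' : Matrix V V R) (w' : V → R) :
    Matrix V V R :=
  (neumann L * L' * neumann L)ᵀ * diagonal w * neumann L +
    (neumann L)ᵀ * diagonal w' * neumann L +
    (neumann L)ᵀ * diagonal w * (neumann L * L' * neumann L)

/-- The two summands involving `L'` are transposes of each other, so they have equal traces against
a symmetric `H`; the rest is cyclicity of the trace. -/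
lemma trace_mul_covarianceDiff {H L L' : Matrix V V R} {w w' : V → R} (hH : H.IsSymm) :
    (H * covarianceDiff L w L' w').trace =
      2 * (neumann L * H * covariance L w * L').trace +
        (neumann L * H * (neumann L)ᵀ * diagonal w').trace := by
  set N := neumann L with hN
  have e1 : (H * ((N * L' * N)ᵀ * diagonal w * N)).trace = (N * H * covariance L w * L').trace := by
    rw [← trace_transpose]
    simp only [transpose_mul, transpose_transpose, diagonal_transpose, hH.eq, covariance, ← hN,
      ← mul_assoc]
    rw [trace_mul_comm]
    simp only [← mul_assoc]
    rw [trace_mul_comm]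
    simp only [← mul_assoc]
  have e2 : (H * (Nᵀ * diagonal w * (N * L' * N))).trace = (N * H * covariance L w * L').trace := by
    simp only [covariance, ← hN, ← mul_assoc]
    rw [trace_mul_comm]
    simp only [← mul_assoc]
  have e3 : (H * (Nᵀ * diagonal w' * N)).trace = (N * H * Nᵀ * diagonal w').trace := by
    simp only [← mul_assoc]
    rw [trace_mul_comm]
    simp only [← mul_assoc]
  rw [covarianceDiff, mul_add, mul_add, trace_add, trace_add, e1, e2, e3]
  ring

end Parametrization

/-! ### Orthogonality of the score and the normal equations. -/

section Critical

variable {V : Type*} {G : Digraph V} {k : Type*} [Field k] [Fintype V] [DecidableEq V]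

/-- With `N = neumann L`, the score equations concern the entries of `N H Σ` along edges and the
diagonal of `N H Nᵀ`. Both identities come from `Σ (1 - L) = Nᵀ diagonal w`, and they translate
these entries into the normal equations for `Σ + ΣHΣ`. -/
lemma score_transformed (hG : IsAcyclic G) {H L : Matrix V V k} {w : V → k} (hH : H.IsSymm)
    (hL : IsSupported G L) :
    (∀ i j, ((covariance L w + covariance L w * H * covariance L w) * (1 - L)) i j =
      (neumann L j i + (neumann L * H * covariance L w) j i) * w j) ∧
    ∀ j, (neumann L * H * covariance L w) j j -
      ∑ i, L i j * (neumann L * H * covariance L w) j i = w j * (neumann L * H * (neumann L)ᵀ) j j := by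
  constructor
  · intro i j
    have : (covariance L w + covariance L w * H * covariance L w) * (1 - L) =
        ((neumann L)ᵀ + (neumann L * H * covariance L w)ᵀ) * diagonal w := by
      rw [add_mul, mul_assoc _ (covariance L w), covariance_mul hG hL, transpose_mul,
        transpose_mul, hH.eq, (covariance_isSymm L w).eq, add_mul]
      simp only [mul_assoc]
    rw [this, mul_diagonal]
    rfl
  · intro j
    have : neumann L * H * covariance L w * (1 - L) =
        neumann L * H * (neumann L)ᵀ * diagonal w := by
      rw [mul_assoc, covariance_mul hG hL]
      simp only [mul_assoc]
    have h2 := congrFun (congrFun this j) j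
    rw [mul_sub, mul_one, Matrix.sub_apply, mul_apply, mul_diagonal] at h2
    rw [mul_comm (w j), ← h2]
    congr 1
    exact Finset.sum_congr rfl fun i _ => mul_comm _ _

lemma normalEquations_of_trace_eq_zero [CharZero k] (hG : IsAcyclic G) {H L : Matrix V V k}
    {w : V → k} (hH : H.IsSymm) (hL : IsSupported G L)
    (h : ∀ (L' : Matrix V V k) (w' : V → k), IsSupported G L' →
      (H * covarianceDiff L w L' w').trace = 0) :
    NormalEquations G (covariance L w + covariance L w * H * covariance L w) L w := by
  obtain ⟨h1, h2⟩ := score_transformed (w := w) hG hH hL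
  have c1 : ∀ i j, G.Adj i j → (neumann L * H * covariance L w) j i = 0 := by
    intro i j hij
    -- Varying a single edge coefficient isolates twice the wanted entry; characteristic zero
    -- removes the factor.
    have := h (Matrix.single i j 1) 0 (fun a b hab => by
      rw [single_apply, if_neg]; rintro ⟨rfl, rfl⟩; exact hab hij)
    rw [trace_mul_covarianceDiff hH, trace_mul_single] at this
    simpa using this
  have c2 : ∀ j, (neumann L * H * (neumann L)ᵀ) j j = 0 := by
    intro j
    have := h 0 (Pi.single j 1) (fun a b hab => rfl)
    rw [trace_mul_covarianceDiff hH, diagonal_single, trace_mul_single] at this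
    simpa using this
  refine ⟨fun i j hij => ?_, fun j => ?_⟩
  · rw [h1, c1 i j hij, neumann_of_adj hG hL hij, add_zero, zero_mul]
  · have h3 := h2 j
    rw [c2, mul_zero, Finset.sum_eq_zero, sub_zero] at h3
    · rw [h1, h3, neumann_self hG hL, add_zero, one_mul]
    · intro i _
      by_cases hij : G.Adj i j
      · rw [c1 i j hij, mul_zero]
      · rw [hL i j hij, zero_mul]

lemma trace_eq_zero_of_normalEquations (hG : IsAcyclic G) {H L : Matrix V V k}
    {w : V → k} (hH : H.IsSymm) (hL : IsSupported G L) (hw : ∀ j, w j ≠ 0)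
    (h : NormalEquations G (covariance L w + covariance L w * H * covariance L w) L w)
    {L' : Matrix V V k} (w' : V → k) (hL' : IsSupported G L') :
    (H * covarianceDiff L w L' w').trace = 0 := by
  obtain ⟨h1, h2⟩ := score_transformed (w := w) hG hH hL
  have c1 : ∀ i j, G.Adj i j → (neumann L * H * covariance L w) j i = 0 := by
    intro i j hij
    have := h.1 i j hij
    rw [h1, neumann_of_adj hG hL hij, zero_add] at this
    exact (mul_eq_zero.1 this).resolve_right (hw j)
  have c2 : ∀ j, (neumann L * H * (neumann L)ᵀ) j j = 0 := by
    intro j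
    have h3 := h2 j
    have h4 := h.2 j
    rw [h1, neumann_self hG hL, add_mul, one_mul, add_eq_left] at h4
    rw [(mul_eq_zero.1 h4).resolve_right (hw j), Finset.sum_eq_zero, sub_zero] at h3
    · exact (mul_eq_zero.1 h3.symm).resolve_left (hw j)
    · intro i _
      by_cases hij : G.Adj i j
      · rw [c1 i j hij, mul_zero]
      · rw [hL i j hij, zero_mul]
  rw [trace_mul_covarianceDiff hH, trace, trace, Finset.sum_eq_zero, Finset.sum_eq_zero]
  · simp
  · intro j _
    rw [diag_apply, mul_diagonal, c2, zero_mul]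
  · intro j _
    rw [diag_apply, mul_apply, Finset.sum_eq_zero]
    intro i _
    by_cases hij : G.Adj i j
    · rw [c1 i j hij, zero_mul]
    · rw [hL' i j hij, mul_zero]

end Critical

open MvPolynomial

/-! ### Tangent vectors as points over the dual numbers. -/

section DualNumbers

variable {k : Type*} [Field k]

/-- First-order Taylor expansion: a common zero `x` with direction `t` satisfies the tangent
equations exactly when `x + εt` is again a common zero. -/
lemma aeval_dualNumber {σ : Type*} [Fintype σ] (x t : σ → k) (f : MvPolynomial σ k) :
    aeval (fun p => (TrivSqZeroExt.inl (x p) + TrivSqZeroExt.inr (t p) : DualNumber k)) f =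
      TrivSqZeroExt.inl (eval x f) + TrivSqZeroExt.inr (∑ p, eval x (pderiv p f) * t p) := by
  classical
  induction f using MvPolynomial.induction_on with
  | C a => simp [TrivSqZeroExt.algebraMap_eq_inl]
  | add p q hp hq =>
    simp only [map_add, hp, hq, add_mul, Finset.sum_add_distrib, TrivSqZeroExt.inl_add,
      TrivSqZeroExt.inr_add]
    abel
  | mul_X p i hp =>
    rw [map_mul, hp, aeval_X]
    ext
    · simp
    · simp only [map_mul, eval_X, Derivation.leibniz, pderiv_X, smul_eq_mul, map_add, add_mul,
        Finset.sum_add_distrib, TrivSqZeroExt.snd_mul, TrivSqZeroExt.snd_add,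
        TrivSqZeroExt.snd_inl, TrivSqZeroExt.snd_inr, TrivSqZeroExt.fst_add,
        TrivSqZeroExt.fst_inl, TrivSqZeroExt.fst_inr, zero_add, add_zero,
        MulOpposite.smul_eq_mul_unop, MulOpposite.unop_op]
      refine congrArg₂ (· + ·) ?_ ?_
      · rw [Finset.sum_eq_single i]
        · simp
        · intro b _ hb
          simp [hb.symm]
        · simp
      · rw [zero_mul, zero_add, Finset.sum_mul]
        refine Finset.sum_congr rfl fun j _ => ?_
        ring

variable {V : Type*} {G : Digraph V}

/-- The matrix `A + ε B` over the dual numbers. -/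
def dualMatrix (A B : Matrix V V k) : Matrix V V (DualNumber k) :=
  fun i j => TrivSqZeroExt.inl (A i j) + TrivSqZeroExt.inr (B i j)

lemma dualMatrix_inj {A B C D : Matrix V V k} (h : dualMatrix A B = dualMatrix C D) :
    A = C ∧ B = D := by
  constructor
  · ext i j
    simpa [dualMatrix] using congrArg TrivSqZeroExt.fst (congrFun (congrFun h i) j)
  · ext i j
    simpa [dualMatrix] using congrArg TrivSqZeroExt.snd (congrFun (congrFun h i) j)

lemma exists_eq_dualMatrix (M : Matrix V V (DualNumber k)) :
    M = dualMatrix (fun i j => (M i j).fst) (fun i j => (M i j).snd) := by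
  ext i j <;> simp [dualMatrix]

lemma dualMatrix_mul [Fintype V] (A B C D : Matrix V V k) :
    dualMatrix A B * dualMatrix C D = dualMatrix (A * C) (A * D + B * C) := by
  ext i j
  · simp [dualMatrix, mul_apply, TrivSqZeroExt.fst_sum]
  · simp only [mul_apply, dualMatrix, TrivSqZeroExt.snd_sum, TrivSqZeroExt.snd_mul,
      Matrix.add_apply, ← Finset.sum_add_distrib, TrivSqZeroExt.snd_add, TrivSqZeroExt.snd_inl,
      TrivSqZeroExt.snd_inr, TrivSqZeroExt.fst_add, TrivSqZeroExt.fst_inl, TrivSqZeroExt.fst_inr,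
      zero_add, add_zero, smul_eq_mul, MulOpposite.smul_eq_mul_unop, MulOpposite.unop_op]

lemma dualMatrix_transpose (A B : Matrix V V k) : (dualMatrix A B)ᵀ = dualMatrix Aᵀ Bᵀ := rfl

lemma dualMatrix_diagonal [DecidableEq V] (w w' : V → k) :
    diagonal (fun j => (TrivSqZeroExt.inl (w j) + TrivSqZeroExt.inr (w' j) : DualNumber k)) =
      dualMatrix (diagonal w) (diagonal w') := by
  ext i j <;> by_cases h : i = j <;> simp [dualMatrix, h]

lemma dualMatrix_one [DecidableEq V] :
    (1 : Matrix V V (DualNumber k)) = dualMatrix 1 0 := by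
  ext i j <;> by_cases h : i = j <;> simp [dualMatrix, one_apply, h]

lemma dualMatrix_sub (A B C D : Matrix V V k) :
    dualMatrix A B - dualMatrix C D = dualMatrix (A - C) (B - D) := by
  ext i j <;> simp [dualMatrix]

lemma IsSupported.dualMatrix {L L' : Matrix V V k} (hL : IsSupported G L)
    (hL' : IsSupported G L') : IsSupported G (dualMatrix L L') := fun i j h => by
  simp [GaussianModel.dualMatrix, hL i j h, hL' i j h]

variable [Fintype V] [DecidableEq V]

/-- The derivative of the inverse of `1 - L` in direction `L'`, checked by multiplying with `1 - (L
+ εL')`. -/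
lemma neumann_dualMatrix (hG : IsAcyclic G) {L L' : Matrix V V k} (hL : IsSupported G L)
    (hL' : IsSupported G L') :
    neumann (dualMatrix L L') = dualMatrix (neumann L) (neumann L * L' * neumann L) := by
  symm
  apply eq_neumann hG (hL.dualMatrix hL')
  rw [dualMatrix_one, dualMatrix_sub, dualMatrix_mul, mul_neumann hG hL, mul_assoc (neumann L),
    ← mul_assoc, mul_neumann hG hL, one_mul, zero_sub, neg_mul, add_neg_cancel]

lemma covariance_dualMatrix (hG : IsAcyclic G) {L L' : Matrix V V k} (hL : IsSupported G L)
    (hL' : IsSupported G L') (w w' : V → k) :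
    covariance (dualMatrix L L')
        (fun j => (TrivSqZeroExt.inl (w j) + TrivSqZeroExt.inr (w' j) : DualNumber k)) =
      dualMatrix (covariance L w) (covarianceDiff L w L' w') := by
  rw [covariance, neumann_dualMatrix hG hL hL', dualMatrix_transpose, dualMatrix_diagonal,
    dualMatrix_mul, dualMatrix_mul, covariance, covarianceDiff]
  congr 1
  rw [add_mul]
  abel

end DualNumbers

/-! ### Pullback of polynomials and birationality of the parametrization. -/

section Pullback

variable {V : Type*} {G : Digraph V}

/-- The index type of the parameters of the Gaussian model: an edge coefficient for each edge
and a variance for each vertex. -/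
abbrev ParamIndex (G : Digraph V) : Type _ := {e : V × V // G.Adj e.1 e.2} ⊕ V

open Classical in
/-- The coefficient matrix of a parameter point. -/
def coeffOf {A : Type*} [CommRing A] (θ : ParamIndex G → A) : Matrix V V A := fun i j =>
  if h : G.Adj i j then θ (Sum.inl ⟨(i, j), h⟩) else 0

/-- The parameter point with the given coefficients and variances. -/
def paramOf {A : Type*} (L : Matrix V V A) (w : V → A) : ParamIndex G → A :=
  Sum.elim (fun e => L e.1.1 e.1.2) w

lemma coeffOf_isSupported {A : Type*} [CommRing A] (θ : ParamIndex G → A) :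
    IsSupported G (coeffOf θ) := fun _ _ h => dif_neg h

lemma coeffOf_paramOf {A : Type*} [CommRing A] {L : Matrix V V A} (hL : IsSupported G L)
    (w : V → A) : coeffOf (paramOf (G := G) L w) = L := by
  ext i j
  rw [coeffOf]
  split_ifs with h
  · rfl
  · rw [hL i j h]

lemma coeffOf_map {A B : Type*} [CommRing A] [CommRing B] (f : A →+* B) (θ : ParamIndex G → A) :
    (coeffOf θ).map f = coeffOf fun e => f (θ e) := by
  ext i j
  simp only [map_apply, coeffOf]
  split_ifs <;> simp

lemma aeval_mvPolynomialX {k : Type*} [Field k] {A : Type*} [CommRing A] [Algebra k A] (x : Matrix V V A) :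
    (mvPolynomialX V V k).map ((aeval (coords x) : _ →ₐ[k] A) : MvPolynomial (V × V) k →+* A) =
      x := by
  ext i j
  simp [coords]

variable [Fintype V] [DecidableEq V]

/-- The covariance matrix of a parameter point. -/
def covarianceOf {A : Type*} [CommRing A] (θ : ParamIndex G → A) : Matrix V V A :=
  covariance (coeffOf θ) (fun j => θ (Sum.inr j))

lemma covarianceOf_paramOf {A : Type*} [CommRing A] {L : Matrix V V A} (hL : IsSupported G L)
    (w : V → A) : covarianceOf (paramOf (G := G) L w) = covariance L w := by
  rw [covarianceOf, coeffOf_paramOf hL]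
  rfl

lemma covarianceOf_map {A B : Type*} [CommRing A] [CommRing B] (f : A →+* B)
    (θ : ParamIndex G → A) : (covarianceOf θ).map f = covarianceOf fun e => f (θ e) := by
  rw [covarianceOf, covariance_map, coeffOf_map, covarianceOf]

variable {k : Type*} [Field k]

variable (G k) in
/-- The covariance matrix of the generic parameter point. -/
def genericCovariance : Matrix V V (MvPolynomial (ParamIndex G) k) := covarianceOf X

variable (G k) in
/-- The pullback of polynomials along the parametrization of the Gaussian model. -/
def pullback : MvPolynomial (V × V) k →ₐ[k] MvPolynomial (ParamIndex G) k :=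
  aeval (coords (genericCovariance G k))

lemma aeval_genericCovariance {A : Type*} [CommRing A] [Algebra k A] (θ : ParamIndex G → A)
    (i j : V) : aeval θ (genericCovariance G k i j) = covarianceOf θ i j := by
  have := covarianceOf_map ((aeval θ : _ →ₐ[k] A) : MvPolynomial (ParamIndex G) k →+* A) X
  simpa [genericCovariance] using congrFun (congrFun this i) j

lemma aeval_pullback {A : Type*} [CommRing A] [Algebra k A] (θ : ParamIndex G → A)
    (f : MvPolynomial (V × V) k) :
    aeval θ (pullback G k f) = aeval (coords (covarianceOf θ)) f := by
  rw [pullback, ← AlgHom.comp_apply, comp_aeval]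
  congr 2
  funext p
  exact aeval_genericCovariance θ p.1 p.2

lemma aeval_covariance_eq_zero {A : Type*} [CommRing A] [Algebra k A]
    {f : MvPolynomial (V × V) k} (hf : pullback G k f = 0) {L : Matrix V V A}
    (hL : IsSupported G L) (w : V → A) : aeval (coords (covariance L w)) f = 0 := by
  rw [← covarianceOf_paramOf hL, ← aeval_pullback, hf, map_zero]

lemma pullback_eq_zero [Infinite k] {f : MvPolynomial (V × V) k}
    (h : ∀ (L : Matrix V V k) (w : V → k), IsSupported G L → eval (coords (covariance L w)) f = 0) :
    pullback G k f = 0 := by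
  refine MvPolynomial.funext fun θ => ?_
  rw [map_zero, ← coe_aeval_eq_eval, RingHom.coe_coe, aeval_pullback]
  exact h _ _ (coeffOf_isSupported θ)

lemma aeval_denom {A : Type*} [CommRing A] [Algebra k A] (x : Matrix V V A) :
    aeval (coords x) (denom G (mvPolynomialX V V k)) = denom G x := by
  have := denom_map (G := G) ((aeval (coords x) : _ →ₐ[k] A) : MvPolynomial (V × V) k →+* A)
    (mvPolynomialX V V k)
  rw [aeval_mvPolynomialX] at this
  exact this.symm

lemma aeval_numCoeff {A : Type*} [CommRing A] [Algebra k A] (x : Matrix V V A) (i j : V) :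
    aeval (coords x) (numCoeff G (mvPolynomialX V V k) i j) = numCoeff G x i j := by
  have := numCoeff_map (G := G) ((aeval (coords x) : _ →ₐ[k] A) : MvPolynomial (V × V) k →+* A)
    (mvPolynomialX V V k) i j
  rw [aeval_mvPolynomialX] at this
  exact this.symm

lemma aeval_numVar {A : Type*} [CommRing A] [Algebra k A] (x : Matrix V V A) (j : V) :
    aeval (coords x) (numVar G (mvPolynomialX V V k) j) = numVar G x j := by
  have := numVar_map (G := G) ((aeval (coords x) : _ →ₐ[k] A) : MvPolynomial (V × V) k →+* A)
    (mvPolynomialX V V k) j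
  rw [aeval_mvPolynomialX] at this
  exact this.symm

variable (G) in
/-- The solution of the normal equations, as a parameter point; `b` is the inverse of the common
denominator. -/
def normalParam {A : Type*} [CommRing A] (x : Matrix V V A) (b : A) : ParamIndex G → A :=
  paramOf (b • numCoeff G x) (b • numVar G x)

lemma covarianceOf_normalParam {A : Type*} [CommRing A] (x : Matrix V V A) (b : A) :
    covarianceOf (normalParam G x b) = covariance (b • numCoeff G x) (b • numVar G x) :=
  covarianceOf_paramOf (fun i j h => by
    rw [Matrix.smul_apply, numCoeff_isSupported x i j h, smul_zero]) _

/-- Polynomial functions of the solution of the normal equations become polynomial in the second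
moments after multiplication by a power of the common denominator. -/
lemma exists_clear_denominators {k : Type} [Field k] (q : MvPolynomial (ParamIndex G) k) :
    ∃ (m : ℕ) (Q : MvPolynomial (V × V) k), ∀ (A : Type) [CommRing A] [Algebra k A]
      (x : Matrix V V A) (b : A), denom G x * b = 1 →
        aeval (coords x) Q = denom G x ^ m * aeval (normalParam G x b) q := by
  induction q using MvPolynomial.induction_on with
  | C a => exact ⟨0, C a, fun A _ _ x b hb => by simp⟩
  | add p q hp hq =>
    obtain ⟨m, P, hP⟩ := hp
    obtain ⟨n, Q, hQ⟩ := hq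
    refine ⟨m + n, denom G (mvPolynomialX V V k) ^ n * P + denom G (mvPolynomialX V V k) ^ m * Q,
      fun A _ _ x b hb => ?_⟩
    rw [map_add, map_mul, map_mul, map_pow, map_pow, aeval_denom, hP A x b hb, hQ A x b hb,
      map_add]
    ring
  | mul_X p e hp =>
    obtain ⟨m, P, hP⟩ := hp
    refine ⟨m + 1, P * (paramOf (numCoeff G (mvPolynomialX V V k))
      (numVar G (mvPolynomialX V V k)) e), fun A _ _ x b hb => ?_⟩
    have : aeval (coords x) (paramOf (numCoeff G (mvPolynomialX V V k))
        (numVar G (mvPolynomialX V V k)) e) = denom G x * normalParam G x b e := by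
      rcases e with e | j
      · change aeval (coords x) (numCoeff G (mvPolynomialX V V k) e.1.1 e.1.2) =
          denom G x * (b * numCoeff G x e.1.1 e.1.2)
        rw [aeval_numCoeff, ← mul_assoc, hb, one_mul]
      · change aeval (coords x) (numVar G (mvPolynomialX V V k) j) =
          denom G x * (b * numVar G x j)
        rw [aeval_numVar, ← mul_assoc, hb, one_mul]
    rw [map_mul, this, hP A x b hb, map_mul, aeval_X]
    ring

/-- The parametrization maps tangent vectors to tangent vectors. -/
lemma sum_pderiv_covarianceDiff (hG : IsAcyclic G) {f : MvPolynomial (V × V) k}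
    (hf : pullback G k f = 0) {L L' : Matrix V V k} (hL : IsSupported G L)
    (hL' : IsSupported G L') (w w' : V → k) :
    ∑ p, eval (coords (covariance L w)) (pderiv p f) * coords (covarianceDiff L w L' w') p = 0 := by
  have h := aeval_covariance_eq_zero hf (hL.dualMatrix hL')
    (fun j => (TrivSqZeroExt.inl (w j) + TrivSqZeroExt.inr (w' j) : DualNumber k))
  rw [covariance_dualMatrix hG hL hL'] at h
  have h2 := aeval_dualNumber (coords (covariance L w)) (coords (covarianceDiff L w L' w')) f
  change aeval (coords (dualMatrix _ _)) f = _ at h2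
  rw [h] at h2
  simpa using congrArg TrivSqZeroExt.snd h2.symm

lemma normalParam_covariance (hG : IsAcyclic G) {A : Type*} [CommRing A] {L : Matrix V V A}
    (hL : IsSupported G L) (w : V → A) {b : A} (hb : denom G (covariance L w) * b = 1) :
    normalParam G (covariance L w) b = paramOf L w := by
  obtain ⟨h1, h2⟩ := (normalEquations_covariance hG hL w).eq_smul hL hb
  rw [normalParam, ← h1, ← h2]

/-- Every parameter polynomial becomes the pullback of a polynomial after multiplication by a
power of the common denominator. -/
lemma exists_pullback_eq (hG : IsAcyclic G) {k : Type} [Field k] [Infinite k]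
    (q : MvPolynomial (ParamIndex G) k) :
    ∃ (m : ℕ) (Q : MvPolynomial (V × V) k), (∀ (A : Type) [CommRing A] [Algebra k A]
      (x : Matrix V V A) (b : A), denom G x * b = 1 →
        aeval (coords x) Q = denom G x ^ m * aeval (normalParam G x b) q) ∧
      pullback G k Q = pullback G k (denom G (mvPolynomialX V V k)) ^ m * q := by
  obtain ⟨m, Q, hQ⟩ := exists_clear_denominators q
  refine ⟨m, Q, hQ, ?_⟩
  -- The parameters `L = 0`, `w = 1` give the identity matrix, where the denominator is one.
  have hd : pullback G k (denom G (mvPolynomialX V V k)) ≠ 0 := by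
    intro h
    have h2 := aeval_covariance_eq_zero h (L := (0 : Matrix V V k)) (fun _ _ _ => rfl) 1
    have h3 : covariance (0 : Matrix V V k) 1 = 1 := by
      have : neumann (0 : Matrix V V k) = 1 :=
        (eq_neumann hG (L := (0 : Matrix V V k)) (fun _ _ _ => rfl) (by simp)).symm
      rw [covariance, this]
      simp
    rw [aeval_denom, h3, denom_one] at h2
    exact one_ne_zero h2
  -- The extra factor makes the identity trivial where the denominator vanishes; elsewhere the
  -- normal equations recover `θ` from its covariance matrix.
  refine mul_left_cancel₀ hd (MvPolynomial.funext fun θ => ?_)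
  simp only [← coe_aeval_eq_eval, RingHom.coe_coe, map_mul, aeval_pullback, map_pow, aeval_denom]
  by_cases h0 : denom G (covarianceOf θ) = 0
  · rw [h0, zero_mul, zero_mul]
  · have hb := mul_inv_cancel₀ h0
    rw [hQ k _ _ hb]
    have : normalParam G (covarianceOf θ) (denom G (covarianceOf θ))⁻¹ = θ := by
      refine (normalParam_covariance hG (coeffOf_isSupported θ) _ hb).trans ?_
      funext e
      rcases e with e | j
      · exact dif_pos e.2
      · rfl
    rw [this]

/-- Where the common denominator does not vanish, all tangent vectors come from tangent vectors
of the parameter space. -/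
lemma exists_eq_covarianceDiff (hG : IsAcyclic G) {k : Type} [Field k] [Infinite k]
    {L : Matrix V V k} (hL : IsSupported G L) (w : V → k) (h0 : denom G (covariance L w) ≠ 0)
    {T : Matrix V V k} (hT : ∀ f : MvPolynomial (V × V) k, pullback G k f = 0 →
      ∑ p, eval (coords (covariance L w)) (pderiv p f) * coords T p = 0) :
    ∃ (L' : Matrix V V k) (w' : V → k), IsSupported G L' ∧ T = covarianceDiff L w L' w' := by
  set M := covariance L w with hM
  set x := dualMatrix M T with hx
  -- The tangency of `T` says that `M + εT` is a point of the closure over the dual numbers.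
  have hx0 : ∀ f : MvPolynomial (V × V) k, pullback G k f = 0 → aeval (coords x) f = 0 := by
    intro f hf
    have h1 := aeval_covariance_eq_zero hf hL w
    have h2 := aeval_dualNumber (coords M) (coords T) f
    change aeval (coords x) f = _ at h2
    rw [h2, hT f hf, TrivSqZeroExt.inr_zero, add_zero, ← coe_aeval_eq_eval, RingHom.coe_coe, h1,
      TrivSqZeroExt.inl_zero]
  have hMx : x.map (TrivSqZeroExt.fstHom k k k : DualNumber k →+* k) = M := by
    ext i j
    simp [hx, dualMatrix]
  have hu : IsUnit (denom G x) := by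
    rw [TrivSqZeroExt.isUnit_iff_isUnit_fst]
    have := denom_map (G := G) (TrivSqZeroExt.fstHom k k k : DualNumber k →+* k) x
    rw [hMx] at this
    rw [this] at h0
    exact isUnit_iff_ne_zero.2 h0
  obtain ⟨b, hb⟩ := hu.exists_right_inv
  have hxb : x = covarianceOf (normalParam G x b) := by
    ext1 i j
    obtain ⟨m, Q, hQ, hQ'⟩ := exists_pullback_eq hG (genericCovariance G k i j)
    -- This polynomial expresses, with denominators cleared, that parametrizing the solution of the
    -- normal equations returns the original matrix. It therefore lies in the ideal, and the
    -- denominator is a unit at `x`.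
    have h1 := hx0 (Q - denom G (mvPolynomialX V V k) ^ m * X (i, j)) (by
      rw [map_sub, map_mul, hQ', map_pow, sub_eq_zero]
      congr 1
      simp [pullback, coords])
    rw [map_sub, hQ _ x b hb, map_mul, map_pow, aeval_denom, aeval_X, aeval_genericCovariance,
      ← mul_sub] at h1
    exact (sub_eq_zero.1 (((hu.pow m).mul_right_eq_zero).1 h1)).symm
  rw [covarianceOf_normalParam] at hxb
  set L₁ := b • numCoeff G x with hL₁
  set w₁ := b • numVar G x with hw₁
  have hL₁s : IsSupported G L₁ := fun i j h => by
    rw [hL₁, Matrix.smul_apply, numCoeff_isSupported x i j h, smul_zero]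
  set φ : DualNumber k →+* k := (TrivSqZeroExt.fstHom k k k : DualNumber k →+* k) with hφ
  have hfst : covariance (L₁.map φ) (fun j => φ (w₁ j)) = covariance L w := by
    rw [← covariance_map, ← hxb, hMx]
  -- Modulo `ε` the recovered parameters must be `L` and `w`, by uniqueness; their `ε`-parts are
  -- then the required tangent directions.
  have huniq := (normalEquations_covariance hG (hL₁s.map φ) (fun j => φ (w₁ j)))
  rw [hfst] at huniq
  have hb' := mul_inv_cancel₀ h0
  obtain ⟨e1, e2⟩ := huniq.eq_smul (hL₁s.map φ) hb'
  obtain ⟨e3, e4⟩ := (normalEquations_covariance hG hL w).eq_smul hL hb'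
  have eL : L₁ = dualMatrix L (fun i j => (L₁ i j).snd) := by
    rw [e3, ← e1]
    exact exists_eq_dualMatrix L₁
  have ew : w₁ = fun j => (TrivSqZeroExt.inl (w j) + TrivSqZeroExt.inr (w₁ j).snd) := by
    rw [e4, ← e2]
    funext j
    exact (TrivSqZeroExt.inl_fst_add_inr_snd_eq (w₁ j)).symm
  have hL's : IsSupported G (fun i j => (L₁ i j).snd) := fun i j h => by
    have := congrArg TrivSqZeroExt.snd (hL₁s i j h)
    simpa using this
  refine ⟨fun i j => (L₁ i j).snd, fun j => (w₁ j).snd, hL's, ?_⟩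
  rw [eL, ew, covariance_dualMatrix hG hL hL's, hx] at hxb
  simpa [dualMatrix] using (dualMatrix_inj hxb).2

end Pullback

/-! ### Uniqueness of the critical point on the closure. -/

section CriticalPoints

variable {V : Type*} {G : Digraph V} [Fintype V]

/-- A linear form that vanishes on all tangent vectors is the differential of a polynomial in the
ideal. -/
lemma exists_gradient_eq {σ k : Type*} [Field k] [Fintype σ] (I : Ideal (MvPolynomial σ k))
    (x h : σ → k)
    (H : ∀ t : σ → k, (∀ f ∈ I, ∑ p, eval x (pderiv p f) * t p = 0) → ∑ p, h p * t p = 0) :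
    ∃ f ∈ I, ∀ p, eval x (pderiv p f) = h p := by
  classical
  let g : MvPolynomial σ k →ₗ[k] (σ → k) :=
    { toFun := fun f p => eval x (pderiv p f)
      map_add' := fun f f' => by ext p; simp
      map_smul' := fun c f => by ext p; simp }
  suffices h ∈ (I.restrictScalars k).map g by
    obtain ⟨f, hf, rfl⟩ := this
    exact ⟨f, hf, fun p => rfl⟩
  by_contra hn
  -- If `h` were not a gradient, a functional would kill all gradients but not `h`; its coefficients
  -- form a tangent vector contradicting `H`.
  obtain ⟨φ, hφ, hle⟩ := Submodule.exists_le_ker_of_notMem hn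
  have key : ∀ v : σ → k, φ v = ∑ p, v p * φ (fun j => if p = j then 1 else 0) := fun v => by
    simpa using LinearMap.pi_apply_eq_sum_univ φ v
  refine hφ ?_
  rw [key]
  refine H _ fun f hf => ?_
  have := hle (Submodule.mem_map_of_mem (f := g) (r := f) (p := I.restrictScalars k) hf)
  rw [LinearMap.mem_ker, key] at this
  exact this

lemma trace_mul_eq_sum {R : Type*} [CommRing R] {H : Matrix V V R} (hH : H.IsSymm)
    (T : Matrix V V R) : (H * T).trace = ∑ p, coords H p * coords T p := by
  rw [Fintype.sum_prod_type, Finset.sum_comm]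
  simp only [trace, diag_apply, mul_apply]
  refine Finset.sum_congr rfl fun i _ => Finset.sum_congr rfl fun j _ => ?_
  simp [coords, hH.apply]

variable [DecidableEq V]

lemma covarianceDiff_isSymm {R : Type*} [CommRing R] (L L' : Matrix V V R) (w w' : V → R) :
    (covarianceDiff L w L' w').IsSymm := by
  simp only [IsSymm, covarianceDiff, transpose_add, transpose_mul, transpose_transpose,
    diagonal_transpose, mul_assoc]
  abel

/-- A critical point is determined by the normal equations for the given second moments. -/
lemma eq_covarianceOf_normalParam (hG : IsAcyclic G) {k : Type} [Field k] [CharZero k]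
    {M H : Matrix V V k} (hH : H.IsSymm)
    (hM : ∀ f : MvPolynomial (V × V) k, pullback G k f = 0 → eval (coords M) f = 0)
    (hcrit : ∀ T : Matrix V V k, (∀ f : MvPolynomial (V × V) k, pullback G k f = 0 →
      ∑ p, eval (coords M) (pderiv p f) * coords T p = 0) → (H * T).trace = 0)
    (h0 : denom G (M + M * H * M) ≠ 0) :
    M = covarianceOf (normalParam G (M + M * H * M) (denom G (M + M * H * M))⁻¹) := by
  have : Infinite k := CharZero.infinite k
  obtain ⟨F, hF, hFM⟩ := exists_gradient_eq (RingHom.ker (pullback G k)) (coords M) (coords H)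
    (fun t ht => by
      exact (trace_mul_eq_sum hH (fun i j => t (i, j))).symm.trans (hcrit _ ht))
  rw [RingHom.mem_ker] at hF
  -- The symmetrized gradient of `F` extends the single matrix `H` at `M` to a polynomial field of
  -- symmetric matrices, and `Sg` extends `M + M * H * M` in the same way.
  let Hg : Matrix V V (MvPolynomial (V × V) k) :=
    fun i j => C (1 / 2) * (pderiv (i, j) F + pderiv (j, i) F)
  let Sg : Matrix V V (MvPolynomial (V × V) k) :=
    mvPolynomialX V V k + mvPolynomialX V V k * Hg * mvPolynomialX V V k
  let Hx : Matrix V V k → Matrix V V k := fun x =>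
    Hg.map ((aeval (coords x) : _ →ₐ[k] k) : MvPolynomial (V × V) k →+* k)
  have hSg : ∀ x : Matrix V V k,
      Sg.map ((aeval (coords x) : _ →ₐ[k] k) : MvPolynomial (V × V) k →+* k) =
        x + x * Hx x * x := by
    intro x
    rw [Matrix.map_add _ (map_add _), Matrix.map_mul, Matrix.map_mul, aeval_mvPolynomialX]
  have hHx : ∀ x i j, Hx x i j =
      1 / 2 * (eval (coords x) (pderiv (i, j) F) + eval (coords x) (pderiv (j, i) F)) := by
    intro x i j
    change eval (coords x) (C (1 / 2) * (pderiv (i, j) F + pderiv (j, i) F)) = _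
    rw [map_mul, map_add, eval_C]
  have hHM : Hx M = H := by
    ext i j
    rw [hHx, hFM, hFM]
    simp only [coords, hH.apply]
    ring
  have hsymm : ∀ x, (Hx x).IsSymm := by
    intro x
    ext i j
    rw [transpose_apply, hHx, hHx, add_comm]
  -- Since `F` vanishes on the model, its gradient is normal to every parametrized tangent vector,
  -- so the extended field satisfies the score equations at every parametrized point.
  have hne : ∀ (L : Matrix V V k) (w : V → k), IsSupported G L →
      NormalEquations G (covariance L w + covariance L w * Hx (covariance L w) * covariance L w)
        L w := by
    intro L w hL
    refine normalEquations_of_trace_eq_zero hG (hsymm _) hL fun L' w' hL' => ?_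
    have h1 := sum_pderiv_covarianceDiff hG hF hL hL' w w'
    have h2 := h1
    rw [← (Equiv.prodComm V V).sum_comp] at h2
    rw [trace_mul_eq_sum (hsymm _)]
    calc _ = 1 / 2 * (∑ p, eval (coords (covariance L w)) (pderiv p F) *
            coords (covarianceDiff L w L' w') p) + 1 / 2 *
          ∑ p, eval (coords (covariance L w)) (pderiv (Equiv.prodComm V V p) F) *
            coords (covarianceDiff L w L' w') (Equiv.prodComm V V p) := by
          rw [Finset.mul_sum, Finset.mul_sum, ← Finset.sum_add_distrib]
          refine Finset.sum_congr rfl fun p _ => ?_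
          rcases p with ⟨i, j⟩
          simp only [coords, hHx, Equiv.prodComm_apply, Prod.swap,
            (covarianceDiff_isSymm L L' w w').apply]
          ring
      _ = 0 := by rw [h1, h2]; simp
  have hcoords : ∀ x : Matrix V V k, (fun p => aeval (coords x) (coords Sg p)) =
      coords (x + x * Hx x * x) := by
    intro x
    rw [← hSg x]
    rfl
  have hden : ∀ x : Matrix V V k, aeval (coords x) (denom G Sg) = denom G (x + x * Hx x * x) := by
    intro x
    rw [← hSg x, denom_map]
    rfl
  ext i j
  obtain ⟨m, Q, hQ⟩ := exists_clear_denominators (genericCovariance G k i j)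
  -- The second factor says that the point is recovered from `Sg`, with denominators cleared. The
  -- factor `denom G Sg` makes the product vanish on the whole parametrized set, even where the
  -- normal equations degenerate, so it vanishes at `M`.
  have hzero := hM (denom G Sg * (aeval (coords Sg) Q - denom G Sg ^ m * X (i, j))) (by
    refine pullback_eq_zero fun L w hL => ?_
    have hn := hne L w hL
    rw [← coe_aeval_eq_eval, RingHom.coe_coe, map_mul, map_sub, map_mul, map_pow, hden,
      ← AlgHom.comp_apply, comp_aeval]
    erw [hcoords]
    rw [aeval_X]
    by_cases hd : denom G (covariance L w + covariance L w * Hx (covariance L w) *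
        covariance L w) = 0
    · rw [hd, zero_mul]
    · have hb := mul_inv_cancel₀ hd
      obtain ⟨e1, e2⟩ := hn.eq_smul hL hb
      rw [hQ k _ _ hb, aeval_genericCovariance, covarianceOf_normalParam, ← e1, ← e2]
      simp [coords])
  rw [← coe_aeval_eq_eval, RingHom.coe_coe, map_mul, map_sub, map_mul, map_pow, hden,
    ← AlgHom.comp_apply, comp_aeval] at hzero
  erw [hcoords] at hzero
  rw [aeval_X, hHM, hQ k _ _ (mul_inv_cancel₀ h0), aeval_genericCovariance, ← mul_sub] at hzero
  have := (mul_eq_zero.1 ((mul_eq_zero.1 hzero).resolve_left h0)).resolve_left (pow_ne_zero m h0)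
  exact (sub_eq_zero.1 this).symm

end CriticalPoints

/-! ### Vanishing ideals and nonsingular points of the closure. -/

section Ideals

variable {V : Type*} {G : Digraph V} [Fintype V] [DecidableEq V]

/-- The admissible real parameters form a product of infinite subsets of `k`, so a polynomial
vanishing on all of them is zero; positivity of the variances is invisible to the ideal. -/
lemma mem_matrixIdeal_dagModel (hG : IsAcyclic G) {k : Type*} [Field k] [Algebra ℝ k]
    (f : MvPolynomial (V × V) k) :
    f ∈ matrixIdeal ((fun A : Matrix V V ℝ => A.map (algebraMap ℝ k)) '' dagModel G) ↔
      pullback G k f = 0 := by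
  constructor
  · intro hf
    refine funext_set (fun e => Sum.elim (fun _ => Set.range (algebraMap ℝ k))
      (fun _ => algebraMap ℝ k '' Set.Ioi 0) e) ?_ fun θ hθ => ?_
    · have hinj := FaithfulSMul.algebraMap_injective ℝ k
      rintro (e | j)
      · exact Set.infinite_range_of_injective hinj
      · exact (Set.Ioi_infinite (0 : ℝ)).image hinj.injOn
    · have hl : ∀ e, ∃ a : ℝ, algebraMap ℝ k a = θ (Sum.inl e) := fun e =>
        hθ (Sum.inl e) trivial
      have hv : ∀ j, ∃ a : ℝ, 0 < a ∧ algebraMap ℝ k a = θ (Sum.inr j) := fun j =>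
        hθ (Sum.inr j) trivial
      choose l hl using hl
      choose v hv0 hv using hv
      rw [map_zero, ← coe_aeval_eq_eval, RingHom.coe_coe, aeval_pullback]
      refine hf _ ⟨_, ⟨covarianceOf (G := G) (Sum.elim l v), ?_, rfl⟩, ?_⟩
      · exact (mem_dagModel_iff hG).2 ⟨_, _, coeffOf_isSupported _, hv0, rfl⟩
      · dsimp only
        rw [covarianceOf_map]
        congr 2
        funext e
        rcases e with e | j
        · exact hl e
        · exact hv j
  · rintro hf _ ⟨_, ⟨A, hA, rfl⟩, rfl⟩
    obtain ⟨L, w, hL, -, rfl⟩ := (mem_dagModel_iff hG).1 hA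
    dsimp only
    rw [covariance_map]
    exact aeval_covariance_eq_zero hf (hL.map _) _

lemma mem_matrixIdeal_dagModel_real (hG : IsAcyclic G) (f : MvPolynomial (V × V) ℝ) :
    f ∈ matrixIdeal (dagModel G) ↔ pullback G ℝ f = 0 := by
  rw [← mem_matrixIdeal_dagModel hG]
  have : (fun A : Matrix V V ℝ => A.map (algebraMap ℝ ℝ)) = id := by
    ext A i j
    rfl
  rw [this, Set.image_id]

lemma mem_complexClosure_iff (hG : IsAcyclic G) (M : Matrix V V ℂ) :
    M ∈ complexClosure (dagModel G) ↔
      ∀ f : MvPolynomial (V × V) ℂ, pullback G ℂ f = 0 → eval (coords M) f = 0 := by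
  refine forall_congr' fun f => ?_
  rw [mem_matrixIdeal_dagModel hG]
  rfl

lemma mem_matrixIdeal_complexClosure (hG : IsAcyclic G) (f : MvPolynomial (V × V) ℂ) :
    f ∈ matrixIdeal (complexClosure (dagModel G)) ↔ pullback G ℂ f = 0 := by
  constructor
  · intro hf
    rw [← mem_matrixIdeal_dagModel hG]
    rintro _ ⟨A, hA, rfl⟩
    refine hf _ ⟨A, ?_, rfl⟩
    intro g hg
    exact hg _ ⟨A, hA, rfl⟩
  · rintro hf _ ⟨M, hM, rfl⟩
    rw [mem_complexClosure_iff hG] at hM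
    exact hM f hf

/-- The points of the closure at which the common denominator does not vanish are nonsingular. -/
lemma isNonsingularPoint_covariance (hG : IsAcyclic G) {L : Matrix V V ℂ} (hL : IsSupported G L)
    (w : V → ℂ) (h0 : denom G (covariance L w) ≠ 0) :
    IsNonsingularPoint (complexClosure (dagModel G)) (covariance L w) := by
  refine ⟨(mem_complexClosure_iff hG _).2 fun f hf => aeval_covariance_eq_zero hf hL w, ?_⟩
  set X := complexClosure (dagModel G) with hX
  set M := covariance L w with hM
  set θ : ParamIndex G → ℂ := paramOf L w with hθ
  have hMθ : covarianceOf θ = M := covarianceOf_paramOf hL w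
  let P : Ideal (MvPolynomial (ParamIndex G) ℂ) := vanishingIdeal ℂ {θ}
  have hP : ∀ q, q ∈ P ↔ aeval θ q = 0 := fun q => mem_vanishingIdeal_singleton_iff θ q
  let φ : (MvPolynomial (V × V) ℂ ⧸ matrixIdeal X) →+* MvPolynomial (ParamIndex G) ℂ :=
    Ideal.Quotient.lift (matrixIdeal X) (pullback G ℂ : _ →+* _)
      (fun f hf => (mem_matrixIdeal_complexClosure hG f).1 hf)
  have hφ : ∀ f, φ (Ideal.Quotient.mk _ f) = pullback G ℂ f := fun f => rfl
  have hφinj : Function.Injective φ := by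
    rw [injective_iff_map_eq_zero]
    intro a ha
    obtain ⟨f, rfl⟩ := Ideal.Quotient.mk_surjective a
    exact Ideal.Quotient.eq_zero_iff_mem.2 ((mem_matrixIdeal_complexClosure hG f).2 ha)
  -- The local ring at `M` is identified with that of the affine parameter space at `θ`, which is
  -- regular.
  let B := Localization.AtPrime P
  let ψ : (MvPolynomial (V × V) ℂ ⧸ matrixIdeal X) →+* B := (algebraMap _ B).comp φ
  let _ : Algebra (MvPolynomial (V × V) ℂ ⧸ matrixIdeal X) B := ψ.toAlgebra
  have hinjB : Function.Injective (algebraMap (MvPolynomial (ParamIndex G) ℂ) B) :=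
    IsLocalization.injective B P.primeCompl_le_nonZeroDivisors
  have hunit : ∀ f : MvPolynomial (V × V) ℂ, aeval (coords M) f ≠ 0 →
      IsUnit (algebraMap (MvPolynomial (ParamIndex G) ℂ) B (pullback G ℂ f)) := by
    intro f hf
    refine IsLocalization.map_units B (⟨pullback G ℂ f, fun h => hf ?_⟩ : P.primeCompl)
    rwa [SetLike.mem_coe, hP, aeval_pullback, hMθ] at h
  have hloc : IsLocalization (Submonoid.map (Ideal.Quotient.mk (matrixIdeal X))
      (vanishingIdeal ℂ {coords M}).primeCompl) B := by
    refine ⟨?_, ?_, ?_⟩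
    · rintro ⟨_, f, hf, rfl⟩
      refine hunit f fun h => hf ((mem_vanishingIdeal_singleton_iff _ _).2 h)
    · intro z
      -- After multiplication by powers of the denominator `d`, both `q` and `s` become pullbacks
      -- `Q` and `Q'`. Thus `q / s` equals `d ^ m' * Q / (d ^ m * Q')`, and `d` does not vanish at
      -- `M`.
      obtain ⟨⟨q, ⟨s, hs⟩⟩, hz⟩ := IsLocalization.surj P.primeCompl z
      obtain ⟨m, Q, -, hQ⟩ := exists_pullback_eq hG q
      obtain ⟨m', Q', -, hQ'⟩ := exists_pullback_eq hG s
      set d : MvPolynomial (V × V) ℂ := denom G (mvPolynomialX V V ℂ) with hd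
      have hdM : aeval (coords M) d ≠ 0 := by rwa [hd, aeval_denom]
      have hQM : aeval (coords M) Q' ≠ 0 := by
        rw [← hMθ, ← aeval_pullback, hQ', map_mul, map_pow, aeval_pullback, hMθ]
        exact mul_ne_zero (pow_ne_zero _ hdM) fun h => hs ((hP s).2 h)
      refine ⟨⟨Ideal.Quotient.mk _ (d ^ m' * Q), Ideal.Quotient.mk _ (d ^ m * Q'),
        d ^ m * Q', fun h => ?_, rfl⟩, ?_⟩
      · rw [SetLike.mem_coe, mem_vanishingIdeal_singleton_iff, map_mul, map_pow] at h
        exact mul_ne_zero (pow_ne_zero _ hdM) hQM h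
      · change z * algebraMap _ B (pullback G ℂ (d ^ m * Q')) =
          algebraMap _ B (pullback G ℂ (d ^ m' * Q))
        dsimp only at hz
        simp only [map_mul, map_pow, hQ, hQ', ← hz]
        ring
    · intro a b hab
      exact ⟨1, by rw [hφinj (hinjB hab)]⟩
  have := MvPolynomial.isRegularRing_of_isRegularRing (R := ℂ) (ι := ParamIndex G)
  have hreg : IsRegularLocalRing B := isRegularRing_iff.1 this P
  exact IsRegularLocalRing.of_ringEquiv (IsLocalization.algEquiv (Submonoid.map
    (Ideal.Quotient.mk (matrixIdeal X)) (vanishingIdeal ℂ {coords M}).primeCompl) B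
      (LocalRingAt X M)).toRingEquiv

end Ideals

/-! ### Derivatives of the determinant and the inverse along a line. -/

section Derivatives

variable {V : Type*} {𝕜 : Type*} [NontriviallyNormedField 𝕜]

lemma continuous_line (M T : Matrix V V 𝕜) : Continuous fun t : 𝕜 => M + t • T := by
  fun_prop

variable [Fintype V] [DecidableEq V]

lemma hasDerivAt_det_line {M : Matrix V V 𝕜} (hM : M.det ≠ 0) (T : Matrix V V 𝕜) :
    HasDerivAt (fun t : 𝕜 => (M + t • T).det) (M.det * (M⁻¹ * T).trace) 0 := by
  have hu : IsUnit M.det := isUnit_iff_ne_zero.2 hM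
  -- After factoring out `M`, the determinant is a polynomial in `t` whose linear coefficient is a
  -- trace; the rest is divisible by `t ^ 2`.
  have h1 : ∀ t : 𝕜, (M + t • T).det = M.det * (1 + (M⁻¹ * T).trace * t +
      ((1 + (Polynomial.X : Polynomial 𝕜) • (M⁻¹ * T).map Polynomial.C).det).divX.divX.eval t *
        t ^ 2) := by
    intro t
    rw [← det_one_add_smul, ← det_mul, mul_add, mul_one, mul_smul_comm, ← mul_assoc,
      mul_nonsing_inv _ hu, one_mul]
  simp only [h1]
  set p := ((1 + (Polynomial.X : Polynomial 𝕜) • (M⁻¹ * T).map Polynomial.C).det).divX.divX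
  have h2 := (((hasDerivAt_id (0 : 𝕜)).const_mul (M⁻¹ * T).trace).const_add 1).add
    ((p.hasDerivAt 0).mul ((hasDerivAt_id (0 : 𝕜)).pow 2))
  simpa using h2.const_mul M.det

lemma hasDerivAt_trace_inv_line {M : Matrix V V 𝕜} (hM : M.det ≠ 0) (S T : Matrix V V 𝕜) :
    HasDerivAt (fun t : 𝕜 => (S * (M + t • T)⁻¹).trace) (-(M⁻¹ * S * M⁻¹ * T).trace) 0 := by
  have hu : IsUnit M.det := isUnit_iff_ne_zero.2 hM
  have hc : Continuous fun t : 𝕜 => (M + t • T).det := (continuous_line M T).matrix_det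
  have hev : ∀ᶠ t in nhds (0 : 𝕜), (M + t • T).det ≠ 0 := by
    refine hc.continuousAt.eventually_ne ?_
    simpa using hM
  have hinv : ContinuousAt (fun t : 𝕜 => (M + t • T)⁻¹) 0 := by
    simp only [inv_def, Ring.inverse_eq_inv']
    refine ContinuousAt.smul (hc.continuousAt.inv₀ ?_)
      (continuous_line M T).matrix_adjugate.continuousAt
    simpa using hM
  rw [hasDerivAt_iff_tendsto_slope]
  have h1 : Filter.Tendsto (fun t : 𝕜 => -(S * ((M + t • T)⁻¹ * T * M⁻¹)).trace)
      (nhdsWithin 0 {0}ᶜ) (nhds (-(M⁻¹ * S * M⁻¹ * T).trace)) := by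
    have hcont : ContinuousAt (fun t : 𝕜 => -(S * ((M + t • T)⁻¹ * T * M⁻¹)).trace) 0 := by
      have : Continuous fun N : Matrix V V 𝕜 => -(S * (N * T * M⁻¹)).trace :=
        (continuous_const.matrix_mul ((continuous_id.matrix_mul continuous_const).matrix_mul
          continuous_const)).matrix_trace.neg
      exact this.continuousAt.comp hinv
    have hval : -(S * ((M + (0 : 𝕜) • T)⁻¹ * T * M⁻¹)).trace = -(M⁻¹ * S * M⁻¹ * T).trace := by
      rw [zero_smul, add_zero, ← mul_assoc, ← mul_assoc, trace_mul_comm]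
      simp only [mul_assoc]
    rw [← hval]
    exact hcont.tendsto.mono_left nhdsWithin_le_nhds
  refine h1.congr' ?_
  filter_upwards [hev.filter_mono nhdsWithin_le_nhds, self_mem_nhdsWithin] with t ht ht0
  have hut : IsUnit (M + t • T).det := isUnit_iff_ne_zero.2 ht
  -- The resolvent identity reduces the difference quotient to continuity of the inverse.
  have key : (M + t • T)⁻¹ - M⁻¹ = t • (-((M + t • T)⁻¹ * T * M⁻¹)) := by
    have e : (M + t • T)⁻¹ * ((M + t • T) - M) * M⁻¹ = M⁻¹ - (M + t • T)⁻¹ := by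
      rw [mul_sub, nonsing_inv_mul _ hut, sub_mul, one_mul, mul_assoc, mul_nonsing_inv _ hu,
        mul_one]
    rw [add_sub_cancel_left, mul_smul_comm, smul_mul_assoc] at e
    rw [smul_neg, e, neg_sub]
  rw [slope_def_field, zero_smul, add_zero, sub_zero, ← trace_sub, ← mul_sub, key, mul_smul_comm,
    trace_smul, mul_neg, trace_neg, smul_eq_mul, mul_div_cancel_left₀ _ ht0]

end Derivatives

/-! ### The score matrix. -/

section Score

variable {V : Type*} [Fintype V] [DecidableEq V]

/-- The gradient of the log-likelihood function at `M` for the second moments `S`, up to the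
factor `n / 2`. -/
def scoreMatrix {k : Type*} [Field k] (M S : Matrix V V k) : Matrix V V k := M⁻¹ * S * M⁻¹ - M⁻¹

lemma scoreMatrix_isSymm {k : Type*} [Field k] {M S : Matrix V V k} (hM : M.IsSymm)
    (hS : S.IsSymm) : (scoreMatrix M S).IsSymm := by
  rw [IsSymm, scoreMatrix, transpose_sub, transpose_mul, transpose_mul, transpose_nonsing_inv,
    hM.eq, hS.eq, mul_assoc]

lemma add_mul_scoreMatrix_mul {k : Type*} [Field k] {M : Matrix V V k} (hM : M.det ≠ 0)
    (S : Matrix V V k) : M + M * scoreMatrix M S * M = S := by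
  have hu : IsUnit M.det := isUnit_iff_ne_zero.2 hM
  rw [scoreMatrix, mul_sub, sub_mul, mul_nonsing_inv _ hu, one_mul, mul_assoc M⁻¹,
    ← mul_assoc M, mul_nonsing_inv _ hu, one_mul, mul_assoc, nonsing_inv_mul _ hu, mul_one]
  abel

lemma complexScore_eq (n : ℕ) {M : Matrix V V ℂ} (hM : M.det ≠ 0) (S T : Matrix V V ℂ) :
    complexScore n M S T = n / 2 * (scoreMatrix M S * T).trace := by
  rw [complexScore, logDeriv_apply, (hasDerivAt_det_line hM T).deriv,
    (hasDerivAt_trace_inv_line hM S T).deriv, zero_smul, add_zero, mul_div_cancel_left₀ _ hM,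
    scoreMatrix, sub_mul, trace_sub]
  ring

lemma hasLineDerivAt_logLik (n : ℕ) {M : Matrix V V ℝ} (hM : M.det ≠ 0) (S T : Matrix V V ℝ) :
    HasLineDerivAt ℝ (fun M => logLik n M S) (n / 2 * (scoreMatrix M S * T).trace) M T := by
  have h0 : (M + (0 : ℝ) • T).det ≠ 0 := by simpa using hM
  have h1 := (((hasDerivAt_det_line hM T).log h0).const_mul (-((n : ℝ) / 2))).sub
    ((hasDerivAt_trace_inv_line hM S T).const_mul ((n : ℝ) / 2))
  refine HasDerivAt.congr_deriv h1 ?_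
  rw [zero_smul, add_zero, mul_div_cancel_left₀ _ hM, scoreMatrix, sub_mul, trace_sub]
  ring

end Score

/-! ### Maximum likelihood degree one. -/

section MLDegree

variable {V : Type*} {G : Digraph V} [Fintype V] [DecidableEq V]

lemma isSymm_of_mem_complexClosure (hG : IsAcyclic G) {M : Matrix V V ℂ}
    (hM : M ∈ complexClosure (dagModel G)) : M.IsSymm := by
  ext i j
  have := (mem_complexClosure_iff hG M).1 hM (X (j, i) - X (i, j)) (by
    refine pullback_eq_zero fun L w _ => ?_
    simp [coords, (covariance_isSymm L w).apply])
  simpa [coords, sub_eq_zero] using this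

lemma mem_tangentSpace_complexClosure_iff (hG : IsAcyclic G) (M T : Matrix V V ℂ) :
    T ∈ tangentSpace (complexClosure (dagModel G)) M ↔
      ∀ f : MvPolynomial (V × V) ℂ, pullback G ℂ f = 0 →
        ∑ p, eval (coords M) (pderiv p f) * coords T p = 0 := by
  refine forall_congr' fun f => ?_
  rw [mem_matrixIdeal_complexClosure hG]

lemma det_covariance_ne_zero {k : Type*} [Field k] (hG : IsAcyclic G) {L : Matrix V V k}
    (hL : IsSupported G L) {w : V → k} (hw : ∀ j, w j ≠ 0) : (covariance L w).det ≠ 0 := by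
  have := (det_neumann_isUnit hG hL).ne_zero
  rw [covariance, det_mul, det_mul, det_transpose, det_diagonal]
  exact mul_ne_zero (mul_ne_zero this (Finset.prod_ne_zero_iff.2 fun j _ => hw j)) this

lemma covarianceOf_normalParam_one (hG : IsAcyclic G) {k : Type*} [Field k] :
    numVar G (1 : Matrix V V k) = 1 ∧ covarianceOf (normalParam G (1 : Matrix V V k) 1) = 1 := by
  have hs : IsSupported G (0 : Matrix V V k) := fun _ _ _ => rfl
  have h1 : NormalEquations G (1 : Matrix V V k) 0 1 := by
    refine ⟨fun i j hij => ?_, fun j => by simp⟩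
    rw [sub_zero, one_mul, one_apply_ne]
    rintro rfl
    exact hG _ (Relation.TransGen.single hij)
  obtain ⟨e1, e2⟩ := h1.eq_smul hs (b := 1) (by rw [denom_one, one_mul])
  have hn : neumann (0 : Matrix V V k) = 1 := (eq_neumann hG hs (by simp)).symm
  refine ⟨by rw [e2, one_smul], ?_⟩
  rw [covarianceOf_normalParam, ← e1, ← e2, covariance, hn]
  simp

theorem hasMLDegree_dagModel (hG : IsAcyclic G) {n : ℕ} (hn : 0 < n) :
    HasMLDegree n (dagModel G) 1 := by
  have hn' : (n : ℂ) / 2 ≠ 0 := div_ne_zero (Nat.cast_ne_zero.2 hn.ne') two_ne_zero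
  obtain ⟨m, Q, hQ⟩ := exists_clear_denominators (denom G (genericCovariance G ℂ))
  have hden : ∀ θ : ParamIndex G → ℂ,
      aeval θ (denom G (genericCovariance G ℂ)) = denom G (covarianceOf θ) := by
    intro θ
    have := denom_map (G := G) ((aeval θ : _ →ₐ[ℂ] ℂ) : MvPolynomial (ParamIndex G) ℂ →+* ℂ)
      (genericCovariance G ℂ)
    have h2 : (genericCovariance G ℂ).map ((aeval θ : _ →ₐ[ℂ] ℂ) :
        MvPolynomial (ParamIndex G) ℂ →+* ℂ) = covarianceOf θ := by
      ext i j
      exact aeval_genericCovariance θ i j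
    rw [h2] at this
    exact this.symm
  -- The first factor makes the normal equations for `S` uniquely solvable, the second makes the
  -- variances, hence the determinant, nonzero. The third keeps the solution off the zero set of its
  -- own denominator, where nonsingularity and the tangent space are under control. At `S = 1` all
  -- three are nonzero.
  let P : MvPolynomial (V × V) ℂ := denom G (mvPolynomialX V V ℂ) *
    (∏ j, numVar G (mvPolynomialX V V ℂ) j) * Q
  have hP : ∀ S : Matrix V V ℂ, eval (coords S) P =
      denom G S * (∏ j, numVar G S j) * aeval (coords S) Q := by
    intro S
    rw [← coe_aeval_eq_eval, RingHom.coe_coe, map_mul, map_mul, aeval_denom, map_prod]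
    simp only [aeval_numVar]
  refine ⟨P, ⟨1, isSymm_one, ?_⟩, fun S hS hPS => ?_⟩
  · obtain ⟨e1, e2⟩ := covarianceOf_normalParam_one hG (k := ℂ)
    rw [hP, denom_one, e1, hQ ℂ 1 1 (by rw [denom_one, one_mul]), hden, e2, denom_one]
    simp
  rw [hP, mul_ne_zero_iff, mul_ne_zero_iff, Finset.prod_ne_zero_iff] at hPS
  obtain ⟨⟨hd, hv⟩, hQS⟩ := hPS
  have hb := mul_inv_cancel₀ hd
  rw [hQ ℂ S _ hb, hden, mul_ne_zero_iff] at hQS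
  set b := (denom G S)⁻¹ with hbdef
  set L := b • numCoeff G S with hLdef
  set w := b • numVar G S with hwdef
  have hL : IsSupported G L := fun i j h => by
    rw [hLdef, Matrix.smul_apply, numCoeff_isSupported S i j h, smul_zero]
  have hw : ∀ j, w j ≠ 0 := fun j => mul_ne_zero (inv_ne_zero hd) (hv j (Finset.mem_univ j))
  have hM0 : denom G (covariance L w) ≠ 0 := by
    have := hQS.2
    rwa [covarianceOf_normalParam] at this
  have hne : NormalEquations G S L w := normalEquations_of_denom_mul_eq_one hb
  have hdet := det_covariance_ne_zero hG hL hw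
  rw [Nat.cast_one, Set.encard_eq_one]
  refine ⟨covariance L w, Set.Subset.antisymm ?_ ?_⟩
  · rintro M ⟨⟨hMX, -⟩, hMdet, hMc⟩
    have hSM := add_mul_scoreMatrix_mul hMdet S
    have := eq_covarianceOf_normalParam hG
      (scoreMatrix_isSymm (isSymm_of_mem_complexClosure hG hMX) hS)
      ((mem_complexClosure_iff hG M).1 hMX)
      (fun T hT => by
        have := hMc T ((mem_tangentSpace_complexClosure_iff hG M T).2 hT)
        rw [complexScore_eq n hMdet] at this
        exact (mul_eq_zero.1 this).resolve_left hn')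
      (by rwa [hSM])
    rw [hSM, covarianceOf_normalParam] at this
    exact this
  · rintro _ rfl
    refine ⟨isNonsingularPoint_covariance hG hL w hM0, hdet, fun T hT => ?_⟩
    rw [mem_tangentSpace_complexClosure_iff hG] at hT
    obtain ⟨L', w', hL', rfl⟩ := exists_eq_covarianceDiff hG hL w hM0 hT
    rw [complexScore_eq n hdet, trace_eq_zero_of_normalEquations hG
      (scoreMatrix_isSymm (covariance_isSymm L w) hS) hL hw _ w' hL', mul_zero]
    rwa [add_mul_scoreMatrix_mul hdet]

end MLDegree

/-! ### Global maximization for positive definite moments. -/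

section Voronoi

variable {V : Type*} {G : Digraph V}

lemma isSymm_of_posDef {S : Matrix V V ℝ} (hS : S.PosDef) : S.IsSymm := by
  have := hS.isHermitian
  rwa [IsHermitian, conjTranspose_eq_transpose_of_trivial] at this

variable [Fintype V] [DecidableEq V]

/-- Nilpotency forces the characteristic polynomial of `L` to be a power of the variable, here
evaluated at one. -/
lemma det_one_sub_of_isSupported (hG : IsAcyclic G) {L : Matrix V V ℝ} (hL : IsSupported G L) :
    (1 - L).det = 1 := by
  have h := isNilpotent_charpoly_sub_pow_of_isNilpotent (M := L) ⟨_, hL.pow_card hG⟩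
  rw [isNilpotent_iff_eq_zero, sub_eq_zero] at h
  have h2 := eval_charpoly L 1
  rw [h] at h2
  simpa using h2.symm

lemma det_covariance (hG : IsAcyclic G) {L : Matrix V V ℝ} (hL : IsSupported G L) (w : V → ℝ) :
    (covariance L w).det = ∏ j, w j := by
  have h : (neumann L).det = 1 := by
    have := congrArg det (mul_neumann hG hL)
    rwa [det_mul, det_one_sub_of_isSupported hG hL, one_mul, det_one] at this
  rw [covariance, det_mul, det_mul, det_transpose, h, det_diagonal, one_mul, mul_one]

lemma inv_covariance (hG : IsAcyclic G) {L : Matrix V V ℝ} (hL : IsSupported G L) {w : V → ℝ}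
    (hw : ∀ j, w j ≠ 0) :
    (covariance L w)⁻¹ = (1 - L) * diagonal (fun j => (w j)⁻¹) * (1 - L)ᵀ := by
  refine inv_eq_right_inv ?_
  rw [← mul_assoc, ← mul_assoc, covariance_mul hG hL, mul_assoc _ (diagonal w),
    diagonal_mul_diagonal]
  simp only [mul_inv_cancel₀ (hw _), diagonal_one, mul_one]
  rw [← transpose_mul, mul_neumann hG hL, transpose_one]

/-- The residual variance of `j` when regressed on its parents with coefficients `L`. -/
def residualVar (S L : Matrix V V ℝ) (j : V) : ℝ :=
  ((1 - L)ᵀ * S * (1 - L) : Matrix V V ℝ) j j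

lemma logLik_covariance (hG : IsAcyclic G) (n : ℕ) {L : Matrix V V ℝ} (hL : IsSupported G L)
    {w : V → ℝ} (hw : ∀ j, 0 < w j) (S : Matrix V V ℝ) :
    logLik n (covariance L w) S =
      -((n : ℝ) / 2) * ∑ j, (Real.log (w j) + residualVar S L j / w j) := by
  have h1 : (S * (covariance L w)⁻¹).trace = ∑ j, residualVar S L j / w j := by
    rw [inv_covariance hG hL fun j => (hw j).ne', ← mul_assoc, trace_mul_comm, ← mul_assoc,
      ← mul_assoc, trace]
    refine Finset.sum_congr rfl fun j _ => ?_
    rw [diag_apply, mul_diagonal, residualVar, div_eq_mul_inv]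
  rw [logLik, h1, det_covariance hG hL, Real.log_prod fun j _ => (hw j).ne',
    Finset.sum_add_distrib]
  ring

lemma residualVar_pos (hG : IsAcyclic G) {S L : Matrix V V ℝ} (hS : S.PosDef)
    (hL : IsSupported G L) (j : V) : 0 < residualVar S L j := by
  have hinj : Function.Injective (1 - L).mulVec := by
    refine mulVec_injective_of_isUnit ?_
    rw [isUnit_iff_isUnit_det, det_one_sub_of_isSupported hG hL]
    exact isUnit_one
  have := (hS.conjTranspose_mul_mul_same hinj).diag_pos (i := j)
  rwa [conjTranspose_eq_transpose_of_trivial] at this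

/-- Pythagoras: the normal equations make the residuals `S`-orthogonal to every change of
coefficients along edges, so the cross terms vanish and only a quadratic form in `L - L'` is added.
-/
lemma NormalEquations.residualVar_eq {S L : Matrix V V ℝ} {w : V → ℝ} (hS : S.IsSymm)
    (hL : IsSupported G L) (h : NormalEquations G S L w) {L' : Matrix V V ℝ}
    (hL' : IsSupported G L') (j : V) :
    residualVar S L' j = w j + ((L - L')ᵀ * S * (L - L')) j j := by
  have key : ∀ D : Matrix V V ℝ, IsSupported G D → (Dᵀ * (S * (1 - L))) j j = 0 := by
    intro D hD
    rw [mul_apply, Finset.sum_eq_zero]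
    intro i _
    by_cases hij : G.Adj i j
    · rw [h.1 i j hij, mul_zero]
    · rw [transpose_apply, hD i j hij, zero_mul]
  have hD : IsSupported G (L - L') := fun i j hij => by
    rw [Matrix.sub_apply, hL i j hij, hL' i j hij, sub_zero]
  have e : (1 - L')ᵀ * S * (1 - L') = S * (1 - L) - Lᵀ * (S * (1 - L)) +
      ((L - L')ᵀ * (S * (1 - L)) + ((L - L')ᵀ * (S * (1 - L)))ᵀ) +
        (L - L')ᵀ * S * (L - L') := by
    have : 1 - L' = (1 - L) + (L - L') := by abel
    rw [this]
    simp only [transpose_mul, transpose_add, transpose_sub, transpose_one, transpose_transpose,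
      hS.eq]
    noncomm_ring
  rw [residualVar, e, Matrix.add_apply, Matrix.add_apply, Matrix.add_apply, Matrix.sub_apply,
    transpose_apply, key L hL, key _ hD, h.2 j]
  ring

lemma denom_ne_zero_of_posDef {x : Matrix V V ℝ} (hx : x.PosDef) : denom G x ≠ 0 := by
  classical
  refine Finset.prod_ne_zero_iff.2 fun j _ => ?_
  exact (hx.submatrix (e := (Subtype.val : {p // G.Adj p j} → V))
    Subtype.val_injective).det_pos.ne'

lemma posDef_covariance (hG : IsAcyclic G) {L : Matrix V V ℝ} (hL : IsSupported G L)
    {w : V → ℝ} (hw : ∀ j, 0 < w j) : (covariance L w).PosDef := by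
  have hinj : Function.Injective (neumann L).mulVec :=
    mulVec_injective_of_isUnit ((isUnit_iff_isUnit_det _).2 (det_neumann_isUnit hG hL))
  have := (PosDef.diagonal hw).conjTranspose_mul_mul_same hinj
  rwa [conjTranspose_eq_transpose_of_trivial] at this

/-- This is `log t ≤ t - 1` at `t = v / w`: each vertex term is smallest when the variance equals
the minimal residual variance. -/
lemma log_add_one_le {v w u : ℝ} (hv : 0 < v) (hw : 0 < w) (hu : v ≤ u) :
    Real.log v + 1 ≤ Real.log w + u / w := by
  have h1 := Real.log_le_sub_one_of_pos (div_pos hv hw)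
  rw [Real.log_div hv.ne' hw.ne'] at h1
  have h2 : v / w ≤ u / w := by gcongr
  linarith

lemma eq_of_log_add_one_eq {v w u : ℝ} (hv : 0 < v) (hw : 0 < w) (hu : v ≤ u)
    (h : Real.log v + 1 = Real.log w + u / w) : w = v ∧ u = v := by
  have h2 : v / w ≤ u / w := by gcongr
  have hwv : v / w = 1 := by
    by_contra hne
    have h1 := Real.log_lt_sub_one_of_pos (div_pos hv hw) hne
    rw [Real.log_div hv.ne' hw.ne'] at h1
    linarith
  have hwv' : v = w := (div_eq_one_iff_eq hw.ne').1 hwv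
  subst hwv'
  exact ⟨rfl, (div_eq_one_iff_eq hw.ne').1 (by linarith)⟩

lemma mem_tangentSpace_dagModel_iff (hG : IsAcyclic G) (M T : Matrix V V ℝ) :
    T ∈ tangentSpace (dagModel G) M ↔ ∀ f : MvPolynomial (V × V) ℝ, pullback G ℝ f = 0 →
      ∑ p, eval (coords M) (pderiv p f) * coords T p = 0 := by
  refine forall_congr' fun f => ?_
  rw [mem_matrixIdeal_dagModel_real hG]

/-- The log-normal spectrahedron is given by the normal equations. -/
lemma mem_logNormalSpectrahedron_iff (hG : IsAcyclic G) {n : ℕ} (hn : 0 < n)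
    {L : Matrix V V ℝ} (hL : IsSupported G L) {w : V → ℝ} (hw : ∀ j, 0 < w j)
    {S : Matrix V V ℝ} (hS : S.PosDef) :
    S ∈ logNormalSpectrahedron n (dagModel G) (covariance L w) ↔ NormalEquations G S L w := by
  have hn' : (n : ℝ) / 2 ≠ 0 := div_ne_zero (Nat.cast_ne_zero.2 hn.ne') two_ne_zero
  have hSs := isSymm_of_posDef hS
  have hdet := det_covariance_ne_zero hG hL fun j => (hw j).ne'
  have hH := scoreMatrix_isSymm (covariance_isSymm L w) hSs
  have hadd := add_mul_scoreMatrix_mul hdet S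
  constructor
  · rintro ⟨-, -, hT⟩
    have := normalEquations_of_trace_eq_zero (w := w) hG hH hL fun L' w' hL' => by
      have h1 := hT (covarianceDiff L w L' w') ((mem_tangentSpace_dagModel_iff hG _ _).2
        fun f hf => sum_pderiv_covarianceDiff hG hf hL hL' w w')
      have h2 := (hasLineDerivAt_logLik n hdet S (covarianceDiff L w L' w')).unique h1
      exact (mul_eq_zero.1 h2).resolve_left hn'
    rwa [hadd] at this
  · intro hne
    refine ⟨hS, hSs, fun T hT => ?_⟩
    rw [mem_tangentSpace_dagModel_iff hG] at hT
    obtain ⟨L', w', hL', rfl⟩ := exists_eq_covarianceDiff hG hL w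
      (denom_ne_zero_of_posDef (posDef_covariance hG hL hw)) hT
    have h1 := hasLineDerivAt_logLik n hdet S (covarianceDiff L w L' w')
    rwa [trace_eq_zero_of_normalEquations hG hH hL (fun j => (hw j).ne') (by rwa [hadd]) w' hL',
      mul_zero] at h1

/-- The logarithmic Voronoi cells are given by the normal equations. -/
lemma mem_logVoronoi_iff (hG : IsAcyclic G) {n : ℕ} (hn : 0 < n)
    {L : Matrix V V ℝ} (hL : IsSupported G L) {w : V → ℝ} (hw : ∀ j, 0 < w j)
    {S : Matrix V V ℝ} (hS : S.PosDef) :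
    S ∈ logVoronoi n (dagModel G) (covariance L w) ↔ NormalEquations G S L w := by
  have hn' : (0 : ℝ) < n / 2 := div_pos (Nat.cast_pos.2 hn) two_pos
  have hSs := isSymm_of_posDef hS
  have hnonneg : ∀ (D : Matrix V V ℝ) j, 0 ≤ (Dᵀ * S * D) j j := fun D j => by
    have := (hS.posSemidef.conjTranspose_mul_mul_same D).diag_nonneg (i := j)
    rwa [conjTranspose_eq_transpose_of_trivial] at this
  have hbest : ∀ {L₀ : Matrix V V ℝ} {w₀ : V → ℝ}, IsSupported G L₀ →
      NormalEquations G S L₀ w₀ → ∀ j, residualVar S L₀ j = w₀ j := by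
    intro L₀ w₀ hL₀ h j
    rw [h.residualVar_eq hSs hL₀ hL₀]
    simp
  constructor
  · rintro ⟨-, hmax⟩
    have hd := mul_inv_cancel₀ (denom_ne_zero_of_posDef (G := G) hS)
    set L₀ := (denom G S)⁻¹ • numCoeff G S with hL₀def
    set w₀ := (denom G S)⁻¹ • numVar G S with hw₀def
    have hL₀ : IsSupported G L₀ := fun i j h => by
      rw [hL₀def, Matrix.smul_apply, numCoeff_isSupported S i j h, smul_zero]
    have hne : NormalEquations G S L₀ w₀ := normalEquations_of_denom_mul_eq_one hd
    have hw₀ : ∀ j, 0 < w₀ j := fun j => by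
      rw [← hbest hL₀ hne]
      exact residualVar_pos hG hS hL₀ j
    have hle : ∀ j, w₀ j ≤ residualVar S L j := fun j => by
      rw [hne.residualVar_eq hSs hL₀ hL]
      linarith [hnonneg (L₀ - L) j]
    have h1 := hmax _ ((mem_dagModel_iff hG).2 ⟨L₀, w₀, hL₀, hw₀, rfl⟩)
    rw [logLik_covariance hG n hL hw, logLik_covariance hG n hL₀ hw₀, neg_mul, neg_mul,
      neg_le_neg_iff, mul_le_mul_iff_right₀ hn'] at h1
    have h2 : ∀ j, Real.log (w₀ j) + residualVar S L₀ j / w₀ j = Real.log (w₀ j) + 1 := fun j => by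
      rw [hbest hL₀ hne, div_self (hw₀ j).ne']
    simp only [h2] at h1
    have h3 : ∀ j ∈ Finset.univ, Real.log (w₀ j) + 1 ≤ Real.log (w j) + residualVar S L j / w j :=
      fun j _ => log_add_one_le (hw₀ j) (hw j) (hle j)
    -- Maximality over the solution `L₀`, `w₀` of the normal equations forces equality of the sums,
    -- hence equality at every vertex.
    have h4 := (Finset.sum_eq_sum_iff_of_le h3).1 (le_antisymm (Finset.sum_le_sum h3) h1)
    have h5 := fun j => eq_of_log_add_one_eq (hw₀ j) (hw j) (hle j) (h4 j (Finset.mem_univ j))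
    have hw_eq : w = w₀ := funext fun j => (h5 j).1
    -- Equal residual variances annihilate the quadratic form on each column of `L₀ - L`, and `S` is
    -- positive definite.
    have hL_eq : L₀ - L = 0 := by
      by_contra hD
      obtain ⟨i, j, hij⟩ : ∃ i j, (L₀ - L) i j ≠ 0 := by
        by_contra! hall
        exact hD (Matrix.ext hall)
      have hpos := hS.dotProduct_mulVec_pos (x := fun i => (L₀ - L) i j)
        (fun h => hij (congrFun h i))
      have hz : ((L₀ - L)ᵀ * S * (L₀ - L)) j j = 0 := by
        have := hne.residualVar_eq hSs hL₀ hL j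
        rw [(h5 j).2] at this
        linarith
      have heq : (star fun i => (L₀ - L) i j) ⬝ᵥ (S *ᵥ fun i => (L₀ - L) i j) =
          ((L₀ - L)ᵀ * S * (L₀ - L)) j j := by
        rw [mul_assoc]
        rfl
      rw [heq, hz] at hpos
      exact lt_irrefl _ hpos
    rw [hw_eq, ← sub_eq_zero.1 hL_eq]
    exact hne
  · intro hne
    refine ⟨hS, fun M hM => ?_⟩
    obtain ⟨L', w', hL', hw', rfl⟩ := (mem_dagModel_iff hG).1 hM
    rw [logLik_covariance hG n hL hw, logLik_covariance hG n hL' hw', neg_mul, neg_mul,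
      neg_le_neg_iff, mul_le_mul_iff_right₀ hn']
    refine Finset.sum_le_sum fun j _ => ?_
    rw [hbest hL hne, div_self (hw j).ne']
    refine log_add_one_le (hw j) (hw' j) ?_
    rw [hne.residualVar_eq hSs hL hL']
    linarith [hnonneg (L - L') j]

end Voronoi

end

end GaussianModel

theorem mainTheorem5 {V : Type*} [Fintype V] [DecidableEq V] (G : Digraph V)
    (hG : GaussianModel.IsAcyclic G) (n : ℕ) (hn : 0 < n) :
    GaussianModel.HasMLDegree n (GaussianModel.dagModel G) 1 ∧
      ∀ Sig ∈ GaussianModel.dagModel G,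
        GaussianModel.logVoronoi n (GaussianModel.dagModel G) Sig =
          GaussianModel.logNormalSpectrahedron n (GaussianModel.dagModel G) Sig := by
  refine ⟨GaussianModel.hasMLDegree_dagModel hG hn, fun Sig hSig => ?_⟩
  obtain ⟨L, w, hL, hw, rfl⟩ := (GaussianModel.mem_dagModel_iff hG).1 hSig
  ext S
  constructor
  · intro h
    exact (GaussianModel.mem_logNormalSpectrahedron_iff hG hn hL hw h.1).2
      ((GaussianModel.mem_logVoronoi_iff hG hn hL hw h.1).1 h)
  · intro h
    exact (GaussianModel.mem_logVoronoi_iff hG hn hL hw h.1).2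
      ((GaussianModel.mem_logNormalSpectrahedron_iff hG hn hL hw h.1).1 h)
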